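/- Let $\mathbb T=\mathbb R/\mathbb Z$ with Lebesgue measure $\mu$, and let $\lambda$ be Lebesgue measure on $\mathbb R$. A function $\varphi:\mathbb T\to\mathbb R$ is said to have an asymmetric logarithmic singularity at $x_0\in\mathbb T$ if $\varphi$ is of class $C^2$ on $\mathbb T\setminus\{x_0\}$ and there are $A,B\in\mathbb R\setminus\{0\}$ with $A\neq B$ such that $$\lim_{x\to x_0^-}\varphi''(x)(x-x_0)^2=A,\qquad \lim_{x\to x_0^+}\varphi''(x)(x-x_0)^2=B.$$ Theorem. For $\mu$-almost every $\alpha\in\mathbb T$ the following holds: for every $x_0\in\mathbb T$ and every $\varphi:\mathbb T\to\mathbb R$ that is $C^2$ on $\mathbb T\setminus\{x_0\}$, has an asymmetric logarithmic singularity at $x_0$ and satisfies $\int_{\mathbb T}\varphi\,d\mu=0$, the cylindrical transformation $$S_{\alpha,\varphi}:\mathbb T\times\mathbb R\to\mathbb T\times\mathbb R,\qquad S_{\alpha,\varphi}(x,y)=(x+\alpha,\;y+\varphi(x)),$$ is ergodic with respect to $\mu\otimes\lambda$: it preserves $\mu\otimes\lambda$, and every invariant measurable set is null or has null complement. -/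

import Mathlib

open MeasureTheory Filter Topology

/-- `φ : 𝕋 → ℝ` is of class `C²` on `𝕋 ∖ {x₀}` and has a logarithmic singularity at `x₀` with
(nonzero) left coefficient `A` and right coefficient `B`:
`φ''(x) (x - x₀)² → A` as `x → x₀⁻` and `φ''(x) (x - x₀)² → B` as `x → x₀⁺`.
Everything is read on the `1`-periodic lift `t ↦ φ (x₀ + t)` to `ℝ`, so that `x₀` corresponds
to `t = 0` and `t` is the signed displacement `x - x₀`. The value `φ x₀` is irrelevant. -/
structure HasLogSingularityWith (φ : UnitAddCircle → ℝ) (x₀ : UnitAddCircle) (A B : ℝ) :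
    Prop where
  contDiffOn : ContDiffOn ℝ 2 (fun t : ℝ => φ (x₀ + (t : UnitAddCircle)))
    {t : ℝ | x₀ + (t : UnitAddCircle) ≠ x₀}
  left_ne_zero : A ≠ 0
  right_ne_zero : B ≠ 0
  tendsto_left : Tendsto
    (fun t : ℝ => iteratedDeriv 2 (fun s : ℝ => φ (x₀ + (s : UnitAddCircle))) t * t ^ 2)
    (𝓝[<] 0) (𝓝 A)
  tendsto_right : Tendsto
    (fun t : ℝ => iteratedDeriv 2 (fun s : ℝ => φ (x₀ + (s : UnitAddCircle))) t * t ^ 2)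
    (𝓝[>] 0) (𝓝 B)

/-- The logarithmic singularity of `φ` at `x₀` is asymmetric: its two coefficients differ.
In terms of second derivatives, the symmetric function `-log x - log (1 - x)` has equal
coefficients `A = B = 1` on the two sides of `0`. -/
def HasAsymmetricLogSingularity (φ : UnitAddCircle → ℝ) (x₀ : UnitAddCircle) : Prop :=
  ∃ A B : ℝ, HasLogSingularityWith φ x₀ A B ∧ A ≠ B

/-- The cylindrical cascade `S_{α,φ} (x, y) = (x + α, φ x + y)` on `𝕋 × ℝ`. -/
def cylindricalCascade (α : UnitAddCircle) (φ : UnitAddCircle → ℝ) :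
    UnitAddCircle × ℝ → UnitAddCircle × ℝ :=
  fun p => (p.1 + α, φ p.1 + p.2)

/-! Write `S_q` for the Birkhoff sum of `φ`, lifted to `ℝ` with the singularity at the integers. The
proof shows that an invariant set `F` is, up to null sets, invariant under every vertical
translation. By Fubini almost every vertical section of `F` is then null or conull, and ergodicity
of the irrational rotation decides which.

The dynamical input is the behaviour of `S_q` when `|α - p/q| ≤ 1/(K q²)`. The points `x + jα` then
fall one in each cell of length `1/q`, at nearly the same relative position, so `S_q` is close to a
sum of `f` over an equispaced grid. At cell midpoints this grid sum is bounded, because `f` has mean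
zero (midpoint rule and Stirling). Moving across a cell, the two singularities contribute increments
of order `A log q` and `-B log q`, which do not cancel since `A ≠ B`. Hence `S_q` crosses every
level `r` in the middle half of every cell, and its slope there is `O(q log q)`: this is
`LogProfile.exists_level_points`. So `S_q` is close to `r` on a union of intervals filling a
proportion of order `1/log q` of the line.

If `q` is about `2^m` this proportion is about `1/m`. A single scale is therefore useless, but
`ae_exists_finset_goodScale` shows that for almost every `α` the harmonic sum over the usable scales
diverges. It rests on Dirichlet's theorem, a lower measure bound in every ball and a density point.

Suppose the set `D` of points of `F` leaving `F` under translation by `r` has positive measure, and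
take a square almost filled by `D`. Over an interval where `S_q` is near `r`, the `q`-th iterate
followed by translation by `-r` sends points of `D` outside `D` but inside the square
(`rectangle_le_strips`). Each such strip thus costs a definite area of the complement `W` of `D` in
the square. The intervals of different scales are quasi-independent (`sum_overlap_le`), so by a
second moment bound the small set `W` cannot pay for all of them (`sum_strip_le`). -/

/-! ### Comparison of a logarithmic profile with logarithms -/

/-- A function on `(0, 1)`, with first and second derivatives `f₁` and `f₂`, whose second derivative
behaves like `B / t²` at `0⁺` and like `A / (1 - t)²` at `1⁻`. -/
structure LogProfile (f f₁ f₂ : ℝ → ℝ) (A B : ℝ) : Prop where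
  hasDerivAt : ∀ t ∈ Set.Ioo (0 : ℝ) 1, HasDerivAt f (f₁ t) t
  hasDerivAt₁ : ∀ t ∈ Set.Ioo (0 : ℝ) 1, HasDerivAt f₁ (f₂ t) t
  continuousOn₂ : ContinuousOn f₂ (Set.Ioo 0 1)
  tendsto_zero : Tendsto (fun t => f₂ t * t ^ 2) (𝓝[>] 0) (𝓝 B)
  tendsto_one : Tendsto (fun t => f₂ t * (1 - t) ^ 2) (𝓝[<] 1) (𝓝 A)

theorem LogProfile.neg {f f₁ f₂ : ℝ → ℝ} {A B : ℝ} (h : LogProfile f f₁ f₂ A B) :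
    LogProfile (fun t => -f t) (fun t => -f₁ t) (fun t => -f₂ t) (-A) (-B) where
  hasDerivAt t ht := (h.hasDerivAt t ht).neg
  hasDerivAt₁ t ht := (h.hasDerivAt₁ t ht).neg
  continuousOn₂ := h.continuousOn₂.neg
  tendsto_zero := by simpa using h.tendsto_zero.neg
  tendsto_one := by simpa using h.tendsto_one.neg

theorem exists_lower_bound_Ioo {h : ℝ → ℝ} (hc : ContinuousOn h (Set.Ioo 0 1))
    (h0 : ∃ c, ∀ᶠ t in 𝓝[>] (0 : ℝ), c ≤ h t) (h1 : ∃ c, ∀ᶠ t in 𝓝[<] (1 : ℝ), c ≤ h t) :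
    ∃ c, ∀ t ∈ Set.Ioo (0 : ℝ) 1, c ≤ h t := by
  obtain ⟨c0, h0⟩ := h0
  obtain ⟨c1, h1⟩ := h1
  obtain ⟨u, hu0, hu⟩ := mem_nhdsGT_iff_exists_Ioo_subset.1 h0
  obtain ⟨v, hv1, hv⟩ := mem_nhdsLT_iff_exists_Ioo_subset.1 h1
  simp only [Set.mem_Ioi, Set.mem_Iio] at hu0 hv1
  have hK : IsCompact (Set.Icc u v) := isCompact_Icc
  obtain ⟨c2, hc2⟩ := hK.bddBelow_image (f := h)
    (hc.mono fun t ht => ⟨hu0.trans_le ht.1, ht.2.trans_lt hv1⟩)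
  refine ⟨min c0 (min c1 c2), fun t ht => ?_⟩
  by_cases htu : t < u
  · exact (min_le_left _ _).trans (hu ⟨ht.1, htu⟩)
  by_cases htv : v < t
  · exact ((min_le_right _ _).trans (min_le_left _ _)).trans (hv ⟨htv, ht.2⟩)
  · exact ((min_le_right _ _).trans (min_le_right _ _)).trans
      (hc2 ⟨t, ⟨not_lt.1 htu, not_lt.1 htv⟩, rfl⟩)

/-- The derivative of the right-hand function is `(B - b + o(1)) / t²` near `0`, hence negative, and
`(A - a + o(1)) / (1 - t)²` near `1`, hence positive. The function therefore increases towards both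
endpoints and is bounded below there; the strict inequalities on `a` and `b` absorb the `o(1)`. -/
theorem LogProfile.exists_deriv_lower_bound {f f₁ f₂ : ℝ → ℝ} {A B : ℝ}
    (h : LogProfile f f₁ f₂ A B) {a b : ℝ} (hb : B < b) (ha : a < A) :
    ∃ c, ∀ t ∈ Set.Ioo (0 : ℝ) 1, c ≤ f₁ t + b / t - a / (1 - t) := by
  have hd : ∀ t ∈ Set.Ioo (0 : ℝ) 1, HasDerivAt (fun t => f₁ t + b / t - a / (1 - t))
      (f₂ t - b / t ^ 2 - a / (1 - t) ^ 2) t := by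
    intro t ht
    have h0 : t ≠ 0 := ht.1.ne'
    have h1 : 1 - t ≠ 0 := (sub_pos.2 ht.2).ne'
    have := ((h.hasDerivAt₁ t ht).add ((hasDerivAt_const t b).div (hasDerivAt_id t) h0)).sub
      ((hasDerivAt_const t a).div ((hasDerivAt_const t (1 : ℝ)).sub (hasDerivAt_id t)) h1)
    refine this.congr_deriv ?_
    simp only [id, zero_mul, mul_one, mul_neg, zero_sub, Pi.sub_apply]
    ring
  have hcont : ContinuousOn (fun t => f₁ t + b / t - a / (1 - t)) (Set.Ioo 0 1) :=
    fun t ht => (hd t ht).continuousAt.continuousWithinAt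
  refine exists_lower_bound_Ioo hcont ?_ ?_
  · have hlim : Tendsto (fun t : ℝ => f₂ t * t ^ 2 - b - a / (1 - t) ^ 2 * t ^ 2) (𝓝[>] 0)
        (𝓝 (B - b - a / (1 - 0) ^ 2 * 0 ^ 2)) := by
      refine (h.tendsto_zero.sub_const b).sub (Tendsto.mono_left ?_ nhdsWithin_le_nhds)
      have : ContinuousAt (fun t : ℝ => a / (1 - t) ^ 2 * t ^ 2) 0 := by
        refine ContinuousAt.mul (ContinuousAt.div (by fun_prop) (by fun_prop) (by norm_num))
          (by fun_prop)
      exact this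
    have hev : ∀ᶠ t in 𝓝[>] (0 : ℝ), f₂ t * t ^ 2 - b - a / (1 - t) ^ 2 * t ^ 2 < 0 :=
      hlim.eventually_lt_const (by simpa using hb)
    obtain ⟨u, hu0, hu⟩ := mem_nhdsGT_iff_exists_Ioo_subset.1
      (hev.and (Ioo_mem_nhdsGT (show (0 : ℝ) < 1 by norm_num)))
    simp only [Set.mem_Ioi] at hu0
    have hanti : AntitoneOn (fun t => f₁ t + b / t - a / (1 - t)) (Set.Ioo 0 u) := by
      refine antitoneOn_of_deriv_nonpos (convex_Ioo 0 u)
        (hcont.mono fun t ht => (hu ht).2) ?_ ?_ <;> rw [interior_Ioo] <;> intro t ht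
      · exact (hd t (hu ht).2).differentiableAt.differentiableWithinAt
      · rw [(hd t (hu ht).2).deriv]
        have h0 : 0 < t ^ 2 := pow_pos ht.1 2
        have h1 := (hu ht).1
        have : f₂ t - b / t ^ 2 - a / (1 - t) ^ 2
            = (f₂ t * t ^ 2 - b - a / (1 - t) ^ 2 * t ^ 2) / t ^ 2 := by
          have ht0 : t ≠ 0 := ht.1.ne'
          have ht1 : 1 - t ≠ 0 := (sub_pos.2 (hu ht).2.2).ne'
          field_simp
        rw [this]
        exact div_nonpos_of_nonpos_of_nonneg h1.le h0.le
    refine ⟨f₁ (u / 2) + b / (u / 2) - a / (1 - u / 2), ?_⟩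
    filter_upwards [Ioo_mem_nhdsGT (show (0 : ℝ) < u / 2 by linarith)] with t ht
    exact hanti ⟨ht.1, by linarith [ht.2]⟩ ⟨by linarith, by linarith⟩ ht.2.le
  · have hlim : Tendsto (fun t : ℝ => f₂ t * (1 - t) ^ 2 - a - b / t ^ 2 * (1 - t) ^ 2) (𝓝[<] 1)
        (𝓝 (A - a - b / 1 ^ 2 * (1 - 1) ^ 2)) := by
      refine (h.tendsto_one.sub_const a).sub (Tendsto.mono_left ?_ nhdsWithin_le_nhds)
      have : ContinuousAt (fun t : ℝ => b / t ^ 2 * (1 - t) ^ 2) 1 := by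
        refine ContinuousAt.mul (ContinuousAt.div (by fun_prop) (by fun_prop) (by norm_num))
          (by fun_prop)
      exact this
    have hev : ∀ᶠ t in 𝓝[<] (1 : ℝ), 0 < f₂ t * (1 - t) ^ 2 - a - b / t ^ 2 * (1 - t) ^ 2 :=
      hlim.eventually_const_lt (by simpa using ha)
    obtain ⟨u, hu0, hu⟩ := mem_nhdsLT_iff_exists_Ioo_subset.1
      (hev.and (Ioo_mem_nhdsLT (show (0 : ℝ) < 1 by norm_num)))
    simp only [Set.mem_Iio] at hu0
    have hmono : MonotoneOn (fun t => f₁ t + b / t - a / (1 - t)) (Set.Ioo u 1) := by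
      refine monotoneOn_of_deriv_nonneg (convex_Ioo u 1)
        (hcont.mono fun t ht => (hu ht).2) ?_ ?_ <;> rw [interior_Ioo] <;> intro t ht
      · exact (hd t (hu ht).2).differentiableAt.differentiableWithinAt
      · rw [(hd t (hu ht).2).deriv]
        have h0 : 0 < (1 - t) ^ 2 := pow_pos (sub_pos.2 ht.2) 2
        have h1 := (hu ht).1
        have : f₂ t - b / t ^ 2 - a / (1 - t) ^ 2
            = (f₂ t * (1 - t) ^ 2 - a - b / t ^ 2 * (1 - t) ^ 2) / (1 - t) ^ 2 := by
          have ht0 : t ≠ 0 := (hu ht).2.1.ne'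
          have ht1 : 1 - t ≠ 0 := (sub_pos.2 ht.2).ne'
          field_simp
          ring
        rw [this]
        exact div_nonneg h1.le h0.le
    refine ⟨f₁ ((1 + u) / 2) + b / ((1 + u) / 2) - a / (1 - (1 + u) / 2), ?_⟩
    filter_upwards [Ioo_mem_nhdsLT (show (1 + u) / 2 < (1 : ℝ) by linarith)] with t ht
    exact hmono ⟨by linarith, by linarith⟩ ⟨by linarith [ht.1], ht.2⟩ ht.1.le

/-- Integrated form of the one-sided bound on the derivative of a logarithmic profile. -/
theorem LogProfile.exists_increment_lower_bound {f f₁ f₂ : ℝ → ℝ} {A B : ℝ}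
    (h : LogProfile f f₁ f₂ A B) {a b : ℝ} (hb : B < b) (ha : a < A) :
    ∃ c, ∀ x y, 0 < x → x ≤ y → y < 1 →
      c * (y - x) - b * (Real.log y - Real.log x) + a * (Real.log (1 - x) - Real.log (1 - y))
        ≤ f y - f x := by
  obtain ⟨c, hc⟩ := h.exists_deriv_lower_bound hb ha
  refine ⟨c, fun x y hx hxy hy => ?_⟩
  have hd : ∀ t ∈ Set.Ioo (0 : ℝ) 1,
      HasDerivAt (fun t => f t + b * Real.log t + a * Real.log (1 - t) - c * t)
        (f₁ t + b / t - a / (1 - t) - c) t := by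
    intro t ht
    have h0 : t ≠ 0 := ht.1.ne'
    have h1 : 1 - t ≠ 0 := (sub_pos.2 ht.2).ne'
    have := (((h.hasDerivAt t ht).add ((Real.hasDerivAt_log h0).const_mul b)).add
      ((((hasDerivAt_id t).const_sub 1).log h1).const_mul a)).sub ((hasDerivAt_id t).const_mul c)
    refine this.congr_deriv ?_
    simp only [id]
    ring
  have hmono : MonotoneOn (fun t => f t + b * Real.log t + a * Real.log (1 - t) - c * t)
      (Set.Ioo 0 1) := by
    refine monotoneOn_of_deriv_nonneg (convex_Ioo 0 1)
      (fun t ht => (hd t ht).continuousAt.continuousWithinAt) ?_ ?_ <;>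
      rw [interior_Ioo] <;> intro t ht
    · exact (hd t ht).differentiableAt.differentiableWithinAt
    · rw [(hd t ht).deriv]
      linarith [hc t ht]
  have := hmono ⟨hx, hxy.trans_lt hy⟩ ⟨hx.trans_le hxy, hy⟩ hxy
  simp only at this
  linarith

/-- The primitive `log t - log (1 - t)` of `1 / t + 1 / (1 - t)` on `(0, 1)`. -/
noncomputable def logit (t : ℝ) : ℝ := Real.log t - Real.log (1 - t)

theorem sub_le_log_sub_log {x y : ℝ} (hx : 0 < x) (hxy : x ≤ y) (hy : y < 1) :
    y - x ≤ Real.log y - Real.log x := by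
  rw [← Real.log_div (by linarith) (by linarith)]
  have h1 := Real.one_sub_inv_le_log_of_pos (show 0 < y / x by positivity [hx.trans_le hxy])
  have : y - x ≤ 1 - (y / x)⁻¹ := by
    rw [inv_div]
    have hy0 : 0 < y := hx.trans_le hxy
    rw [show 1 - x / y = (y - x) / y by field_simp, le_div_iff₀ hy0]
    nlinarith
  linarith

/-- The one-sided increment bound, applied to `f` and `-f` with coefficients larger than `|A|` and
`|B|`, makes `f` Lipschitz in the coordinate `logit`. The linear term is absorbed by `y - x ≤ log y
- log x`. -/
theorem LogProfile.exists_abs_increment_le {f f₁ f₂ : ℝ → ℝ} {A B : ℝ}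
    (h : LogProfile f f₁ f₂ A B) :
    ∃ C, 0 < C ∧ ∀ x y, 0 < x → x ≤ y → y < 1 → |f y - f x| ≤ C * (logit y - logit x) := by
  obtain ⟨c, hc⟩ := h.exists_increment_lower_bound (b := |B| + 1) (a := -(|A| + 1))
    (by linarith [le_abs_self B]) (by linarith [neg_abs_le A])
  obtain ⟨d, hd⟩ := h.neg.exists_increment_lower_bound (b := |B| + 1) (a := -(|A| + 1))
    (by linarith [neg_abs_le B]) (by linarith [le_abs_self A])
  have hA := abs_nonneg A
  have hB := abs_nonneg B
  have hc' := abs_nonneg c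
  have hd' := abs_nonneg d
  refine ⟨|A| + |B| + |c| + |d| + 1, by positivity, fun x y hx hxy hy => ?_⟩
  have h1 := hc x y hx hxy hy
  have h2 := hd x y hx hxy hy
  have h3 := sub_le_log_sub_log hx hxy hy
  have h4 : 0 ≤ Real.log (1 - x) - Real.log (1 - y) :=
    sub_nonneg.2 (Real.log_le_log (by linarith) (by linarith))
  have h5 : 0 ≤ y - x := by linarith
  have h6 : -c * (y - x) ≤ |c| * (Real.log y - Real.log x) :=
    (mul_le_mul_of_nonneg_right (neg_le_abs c) h5).trans (mul_le_mul_of_nonneg_left h3 hc')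
  have h7 : -d * (y - x) ≤ |d| * (Real.log y - Real.log x) :=
    (mul_le_mul_of_nonneg_right (neg_le_abs d) h5).trans (mul_le_mul_of_nonneg_left h3 hd')
  have h8 : 0 ≤ Real.log y - Real.log x := h5.trans h3
  unfold logit
  set u := Real.log y - Real.log x
  set v := Real.log (1 - x) - Real.log (1 - y)
  have huv : Real.log y - Real.log (1 - y) - (Real.log x - Real.log (1 - x)) = u + v := by
    simp only [u, v]; ring
  rw [huv, abs_le]
  constructor
  · nlinarith [mul_nonneg hA h4, mul_nonneg hB h4, mul_nonneg hc' h4, mul_nonneg hd' h4,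
      mul_nonneg hA h8, mul_nonneg hB h8, mul_nonneg hc' h8, mul_nonneg hd' h8]
  · nlinarith [mul_nonneg hA h4, mul_nonneg hB h4, mul_nonneg hc' h4, mul_nonneg hd' h4,
      mul_nonneg hA h8, mul_nonneg hB h8, mul_nonneg hc' h8, mul_nonneg hd' h8]

theorem LogProfile.exists_abs_snd_deriv_le {f f₁ f₂ : ℝ → ℝ} {A B : ℝ}
    (h : LogProfile f f₁ f₂ A B) :
    ∃ C, 0 < C ∧ ∀ t ∈ Set.Ioo (0 : ℝ) 1, |f₂ t| ≤ C * (1 / t ^ 2 + 1 / (1 - t) ^ 2) := by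
  have hc : ContinuousOn (fun t => -|f₂ t * t ^ 2 * (1 - t) ^ 2|) (Set.Ioo 0 1) :=
    (((h.continuousOn₂.mul (by fun_prop)).mul (by fun_prop)).abs).neg
  obtain ⟨c, hc⟩ := exists_lower_bound_Ioo hc
    (by
      have : Tendsto (fun t : ℝ => -|f₂ t * t ^ 2 * (1 - t) ^ 2|) (𝓝[>] 0)
          (𝓝 (-|B * (1 - 0) ^ 2|)) :=
        ((h.tendsto_zero.mul (Tendsto.mono_left (Continuous.tendsto
          (f := fun t : ℝ => (1 - t) ^ 2) (by fun_prop) 0) nhdsWithin_le_nhds)).abs).neg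
      exact ⟨_, (this.eventually_const_lt (sub_one_lt _)).mono fun t ht => ht.le⟩)
    (by
      have : Tendsto (fun t : ℝ => -|f₂ t * (1 - t) ^ 2 * t ^ 2|) (𝓝[<] 1)
          (𝓝 (-|A * 1 ^ 2|)) :=
        ((h.tendsto_one.mul (Tendsto.mono_left (Continuous.tendsto
          (f := fun t : ℝ => t ^ 2) (by fun_prop) 1) nhdsWithin_le_nhds)).abs).neg
      refine ⟨-|A * 1 ^ 2| - 1, ?_⟩
      filter_upwards [this.eventually_const_lt (sub_one_lt _)] with t ht
      rw [mul_right_comm]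
      exact ht.le)
  refine ⟨2 * |c| + 1, by positivity, fun t ht => ?_⟩
  have h0 : 0 < t := ht.1
  have h1 : 0 < 1 - t := sub_pos.2 ht.2
  have h2 := hc t ht
  rw [abs_mul, abs_mul, abs_of_pos (pow_pos h0 2), abs_of_pos (pow_pos h1 2)] at h2
  have h3 : |f₂ t| * t ^ 2 * (1 - t) ^ 2 ≤ |c| := by linarith [neg_abs_le c]
  have h4 : |f₂ t| ≤ |c| * (1 / t + 1 / (1 - t)) ^ 2 := by
    have : (1 / t + 1 / (1 - t)) ^ 2 = 1 / (t ^ 2 * (1 - t) ^ 2) := by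
      field_simp; ring
    rw [this, mul_one_div, le_div_iff₀ (by positivity)]
    linarith
  have h5 : (1 / t + 1 / (1 - t)) ^ 2 ≤ 2 * (1 / t ^ 2 + 1 / (1 - t) ^ 2) := by
    have := sq_nonneg (1 / t - 1 / (1 - t))
    have e1 : (1 / t) ^ 2 = 1 / t ^ 2 := by rw [one_div_pow]
    have e2 : (1 / (1 - t)) ^ 2 = 1 / (1 - t) ^ 2 := by rw [one_div_pow]
    nlinarith
  calc |f₂ t| ≤ |c| * (2 * (1 / t ^ 2 + 1 / (1 - t) ^ 2)) :=
        h4.trans (mul_le_mul_of_nonneg_left h5 (abs_nonneg c))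
    _ ≤ _ := by
        have : 0 ≤ 1 / t ^ 2 + 1 / (1 - t) ^ 2 := by positivity
        nlinarith

/-! ### Bounded midpoint sums -/

theorem tangent_le_of_monotoneOn_deriv {k k₁ : ℝ → ℝ}
    (hk : ∀ t ∈ Set.Ioo (0 : ℝ) 1, HasDerivAt k (k₁ t) t) (hm : MonotoneOn k₁ (Set.Ioo 0 1))
    {m t : ℝ} (hm0 : m ∈ Set.Ioo (0 : ℝ) 1) (ht : t ∈ Set.Ioo (0 : ℝ) 1) :
    k m + k₁ m * (t - m) ≤ k t := by
  have hconv : ConvexOn ℝ (Set.Ioo 0 1) k := by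
    refine MonotoneOn.convexOn_of_deriv (convex_Ioo 0 1)
      (fun t ht => (hk t ht).continuousAt.continuousWithinAt) ?_ ?_ <;> rw [interior_Ioo]
    · exact fun t ht => (hk t ht).differentiableAt.differentiableWithinAt
    · exact hm.congr fun t ht => (hk t ht).deriv.symm
  rcases lt_trichotomy m t with h | h | h
  · have := hconv.le_slope_of_hasDerivAt hm0 ht h (hk m hm0)
    rw [slope_def_field, le_div_iff₀ (sub_pos.2 h)] at this
    linarith
  · simp [h]
  · have := hconv.slope_le_of_hasDerivAt ht hm0 h (hk m hm0)
    rw [slope_def_field, div_le_iff₀ (sub_pos.2 h)] at this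
    linarith

/-- A convex function lies above its tangent at the midpoint of each cell, and that tangent
integrates over the cell to the midpoint value divided by `q`. -/
theorem midpoint_sum_le {k k₁ : ℝ → ℝ}
    (hk : ∀ t ∈ Set.Ioo (0 : ℝ) 1, HasDerivAt k (k₁ t) t) (hm : MonotoneOn k₁ (Set.Ioo 0 1))
    (hint : IntervalIntegrable k volume 0 1) {q : ℕ} (hq : 0 < q) :
    ∑ j ∈ Finset.range q, k ((j + 1 / 2) / q) ≤ q * ∫ t in (0 : ℝ)..1, k t := by
  have hq' : (0 : ℝ) < q := Nat.cast_pos.2 hq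
  have hcell : ∀ j < q, Set.uIcc ((j : ℝ) / q) (((j + 1 : ℕ) : ℝ) / q) ⊆ Set.uIcc 0 1 := by
    intro j hj
    have h1 : (j : ℝ) + 1 ≤ q := by exact_mod_cast hj
    rw [Set.uIcc_of_le (by push_cast; gcongr; linarith), Set.uIcc_of_le zero_le_one]
    refine Set.Icc_subset_Icc (by positivity) ?_
    rw [div_le_one hq']
    exact_mod_cast hj
  have hi : ∀ j < q, IntervalIntegrable k volume ((j : ℝ) / q) (((j + 1 : ℕ) : ℝ) / q) :=
    fun j hj => hint.mono_set (hcell j hj)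
  have hsum := intervalIntegral.sum_integral_adjacent_intervals (a := fun j : ℕ => (j : ℝ) / q) hi
  simp only [Nat.cast_zero, zero_div, div_self hq'.ne'] at hsum
  rw [← hsum, Finset.mul_sum]
  refine Finset.sum_le_sum fun j hj => ?_
  have hj := Finset.mem_range.1 hj
  have h1 : (j : ℝ) + 1 ≤ q := by exact_mod_cast hj
  have hj0 : (0 : ℝ) ≤ j := Nat.cast_nonneg j
  set m : ℝ := (j + 1 / 2) / q with hmdef
  have hmmem : m ∈ Set.Ioo (0 : ℝ) 1 := by
    refine ⟨by positivity, ?_⟩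
    rw [hmdef, div_lt_one hq']; linarith
  have hle : (j : ℝ) / q ≤ ((j + 1 : ℕ) : ℝ) / q := by push_cast; gcongr; linarith
  have hlin : IntervalIntegrable (fun t => k m + k₁ m * (t - m)) volume
      ((j : ℝ) / q) (((j + 1 : ℕ) : ℝ) / q) :=
    Continuous.intervalIntegrable (by fun_prop) _ _
  have hmono := intervalIntegral.integral_mono_on_of_le_Ioo hle hlin (hi j hj) (fun t ht => by
    refine tangent_le_of_monotoneOn_deriv hk hm hmmem ⟨?_, ?_⟩
    · exact lt_of_le_of_lt (by positivity) ht.1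
    · refine ht.2.trans_le ?_
      rw [div_le_one hq']
      exact_mod_cast hj)
  have hval : ∫ t in ((j : ℝ) / q)..(((j + 1 : ℕ) : ℝ) / q), (k m + k₁ m * (t - m)) = k m / q := by
    rw [intervalIntegral.integral_add (by simp) (Continuous.intervalIntegrable (by fun_prop) _ _),
      intervalIntegral.integral_const_mul, intervalIntegral.integral_sub
        (by simp) (by simp), integral_id]
    simp only [intervalIntegral.integral_const, smul_eq_mul]
    rw [hmdef]
    push_cast
    field_simp
    ring
  rw [hval] at hmono
  calc k m = q * (k m / q) := by field_simp
    _ ≤ _ := mul_le_mul_of_nonneg_left hmono hq'.le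

/-- This is `∏ (j + 1/2) = (2q)! / (4^q q!)`, which brings the sum within reach of Stirling's
formula. -/
theorem sum_log_add_half_eq (q : ℕ) :
    ∑ j ∈ Finset.range q, Real.log (j + 1 / 2)
      = Real.log (2 * q).factorial - Real.log q.factorial - q * (2 * Real.log 2) := by
  induction q with
  | zero => simp
  | succ n ih =>
    rw [Finset.sum_range_succ, ih, show 2 * (n + 1) = 2 * n + 1 + 1 by ring,
      Nat.factorial_succ (2 * n + 1), Nat.factorial_succ (2 * n), Nat.factorial_succ n]
    have h1 : ((2 * n).factorial : ℝ) ≠ 0 := by positivity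
    have h2 : (n.factorial : ℝ) ≠ 0 := by positivity
    have h3 : (n : ℝ) + 1 ≠ 0 := by positivity
    have h4 : (2 * n : ℝ) + 1 ≠ 0 := by positivity
    push_cast
    rw [Real.log_mul (by positivity) (by positivity), Real.log_mul h4 h1, Real.log_mul h3 h2,
      show (2 * n : ℝ) + 1 + 1 = 2 * (n + 1) by ring, Real.log_mul (by norm_num) h3,
      show (n : ℝ) + 1 / 2 = (2 * n + 1) / 2 by ring, Real.log_div h4 (by norm_num)]
    ring

theorem exists_sum_log_add_half_le :
    ∃ C : ℝ, ∀ q : ℕ, 0 < q →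
      ∑ j ∈ Finset.range q, Real.log (j + 1 / 2) ≤ q * Real.log q - q + C := by
  refine ⟨Real.log (Stirling.stirlingSeq 1) + 1 / 2 * Real.log 4 - Real.log (2 * Real.pi) / 2,
    fun q hq => ?_⟩
  have hq' : (0 : ℝ) < q := Nat.cast_pos.2 hq
  rw [sum_log_add_half_eq]
  have h1 := Stirling.le_log_factorial_stirling hq.ne'
  have h2 := Stirling.log_stirlingSeq_formula (2 * q)
  have h3 : Real.log (Stirling.stirlingSeq (2 * q)) ≤ Real.log (Stirling.stirlingSeq 1) := by
    have := Stirling.log_stirlingSeq'_antitone (Nat.zero_le (2 * q - 1))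
    simp only [Function.comp, Nat.succ_eq_add_one, zero_add] at this
    rwa [Nat.sub_add_cancel (by omega)] at this
  push_cast at h2
  rw [Real.log_div (by positivity) (Real.exp_ne_zero 1), Real.log_exp,
    show (2 : ℝ) * (2 * q) = 4 * q by ring, Real.log_mul (by norm_num) hq'.ne',
    Real.log_mul (by norm_num) hq'.ne'] at h2
  nlinarith

theorem intervalIntegrable_log_one_sub :
    IntervalIntegrable (fun t => Real.log (1 - t)) volume 0 1 := by
  have := (intervalIntegral.intervalIntegrable_log' (a := 0) (b := 1)).comp_sub_left 1
  simpa using this.symm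

theorem LogProfile.intervalIntegrable {f f₁ f₂ : ℝ → ℝ} {A B : ℝ}
    (h : LogProfile f f₁ f₂ A B) : IntervalIntegrable f volume 0 1 := by
  obtain ⟨C, hC, hf⟩ := h.exists_abs_increment_le
  have hg : IntervalIntegrable (fun t => |f (1 / 2)| + C * (|Real.log t| + |Real.log (1 - t)|))
      volume 0 1 :=
    (intervalIntegrable_const).add
      ((intervalIntegral.intervalIntegrable_log'.abs.add
        intervalIntegrable_log_one_sub.abs).const_mul C)
  rw [intervalIntegrable_iff_integrableOn_Ioo_of_le zero_le_one] at hg ⊢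
  refine hg.mono' ?_ ?_
  · exact ContinuousOn.aestronglyMeasurable
      (fun t ht => (h.hasDerivAt t ht).continuousAt.continuousWithinAt) measurableSet_Ioo
  · refine (ae_restrict_iff' measurableSet_Ioo).2 (ae_of_all _ fun t ht => ?_)
    have hl : logit (1 / 2) = 0 := by unfold logit; norm_num
    have key : |f t - f (1 / 2)| ≤ C * |logit t| := by
      rcases le_total t (1 / 2) with h1 | h1
      · have := hf t (1 / 2) ht.1 h1 (by norm_num)
        rw [abs_sub_comm]
        refine this.trans (mul_le_mul_of_nonneg_left ?_ hC.le)
        rw [hl, zero_sub]; exact neg_le_abs _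
      · have := hf (1 / 2) t (by norm_num) h1 ht.2
        refine this.trans (mul_le_mul_of_nonneg_left ?_ hC.le)
        rw [hl, sub_zero]; exact le_abs_self _
    have h2 : |logit t| ≤ |Real.log t| + |Real.log (1 - t)| := abs_sub _ _
    rw [Real.norm_eq_abs]
    have h3 := abs_add_le (f t - f (1 / 2)) (f (1 / 2))
    rw [sub_add_cancel] at h3
    nlinarith

theorem sum_log_cell (q : ℕ) (hq : 0 < q) {u : ℝ} (hu : 0 < u) :
    ∑ j ∈ Finset.range q, Real.log ((j + u) / q)
      = ∑ j ∈ Finset.range q, Real.log (j + u) - q * Real.log q := by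
  have hq' : (0 : ℝ) < q := Nat.cast_pos.2 hq
  rw [Finset.sum_congr rfl fun j _ => Real.log_div (by positivity) hq'.ne']
  simp

theorem one_sub_cell {q j : ℕ} (hj : j < q) (u : ℝ) :
    1 - ((j : ℝ) + u) / q = (((q - 1 - j : ℕ) : ℝ) + (1 - u)) / q := by
  have hq' : (0 : ℝ) < q := Nat.cast_pos.2 (by omega)
  have : ((q - 1 - j : ℕ) : ℝ) = q - 1 - j := by
    rw [Nat.cast_sub (by omega), Nat.cast_sub (by omega)]; simp
  rw [this]
  field_simp
  ring

theorem sum_one_sub_cell (w : ℝ → ℝ) (q : ℕ) (u : ℝ) :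
    ∑ j ∈ Finset.range q, w (1 - ((j : ℝ) + u) / q)
      = ∑ j ∈ Finset.range q, w (((j : ℝ) + (1 - u)) / q) := by
  rw [← Finset.sum_range_reflect (fun j : ℕ => w (((j : ℝ) + (1 - u)) / q))]
  refine Finset.sum_congr rfl fun j hj => ?_
  rw [one_sub_cell (Finset.mem_range.1 hj)]

/-- Adding a multiple `C` of `l = -log t - log (1 - t)` makes `f` convex, so the midpoint rule
bounds the sum of `f + C l` by `q ∫ (f + C l) = 2 C q`. By Stirling the midpoint sum of `l` is
itself at least `2 q - O(1)`, so the linear terms cancel and the sum of `f` is bounded above. The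
lower bound comes from `-f`. -/
theorem LogProfile.exists_abs_midpoint_sum_le {f f₁ f₂ : ℝ → ℝ} {A B : ℝ}
    (h : LogProfile f f₁ f₂ A B) (hint : ∫ t in (0 : ℝ)..1, f t = 0) :
    ∃ C, ∀ q : ℕ, 0 < q → |∑ j ∈ Finset.range q, f ((j + 1 / 2) / q)| ≤ C := by
  obtain ⟨D, hD⟩ := exists_sum_log_add_half_le
  have upper : ∀ {f f₁ f₂ : ℝ → ℝ} {A B : ℝ}, LogProfile f f₁ f₂ A B →
      ∫ t in (0 : ℝ)..1, f t = 0 → ∃ C, ∀ q : ℕ, 0 < q →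
        ∑ j ∈ Finset.range q, f ((j + 1 / 2) / q) ≤ C := by
    intro f f₁ f₂ A B h hint
    obtain ⟨C, hC, hf⟩ := h.exists_abs_snd_deriv_le
    refine ⟨2 * C * D, fun q hq => ?_⟩
    have hq' : (0 : ℝ) < q := Nat.cast_pos.2 hq
    set l : ℝ → ℝ := fun t => -Real.log t - Real.log (1 - t) with hl
    have hder : ∀ t ∈ Set.Ioo (0 : ℝ) 1, HasDerivAt (fun t => f t + C * l t)
        (f₁ t + C * (-t⁻¹ + (1 - t)⁻¹)) t := by
      intro t ht
      have h1 : 1 - t ≠ 0 := (sub_pos.2 ht.2).ne'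
      refine ((h.hasDerivAt t ht).add (((Real.hasDerivAt_log ht.1.ne').neg.sub
        (((hasDerivAt_id t).const_sub 1).log h1)).const_mul C)).congr_deriv ?_
      simp only [id]
      ring
    have hder2 : ∀ t ∈ Set.Ioo (0 : ℝ) 1, HasDerivAt (fun t => f₁ t + C * (-t⁻¹ + (1 - t)⁻¹))
        (f₂ t + C * (1 / t ^ 2 + 1 / (1 - t) ^ 2)) t := by
      intro t ht
      have h1 : 1 - t ≠ 0 := (sub_pos.2 ht.2).ne'
      refine ((h.hasDerivAt₁ t ht).add (((hasDerivAt_inv ht.1.ne').neg.add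
        (((hasDerivAt_id t).const_sub 1).fun_inv h1)).const_mul C)).congr_deriv ?_
      simp only [id]
      ring
    have hmono : MonotoneOn (fun t => f₁ t + C * (-t⁻¹ + (1 - t)⁻¹)) (Set.Ioo 0 1) := by
      refine monotoneOn_of_deriv_nonneg (convex_Ioo 0 1)
        (fun t ht => (hder2 t ht).continuousAt.continuousWithinAt) ?_ ?_ <;>
        rw [interior_Ioo] <;> intro t ht
      · exact (hder2 t ht).differentiableAt.differentiableWithinAt
      · rw [(hder2 t ht).deriv]
        linarith [hf t ht, neg_abs_le (f₂ t)]
    have hli : IntervalIntegrable l volume 0 1 :=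
      intervalIntegral.intervalIntegrable_log'.neg.sub intervalIntegrable_log_one_sub
    have hlint : ∫ t in (0 : ℝ)..1, l t = 2 := by
      have hneg : IntervalIntegrable (fun t => -Real.log t) volume 0 1 :=
        intervalIntegral.intervalIntegrable_log'.neg
      simp only [hl]
      rw [intervalIntegral.integral_sub hneg
        intervalIntegrable_log_one_sub, intervalIntegral.integral_neg,
        intervalIntegral.integral_comp_sub_left (fun t => Real.log t) 1]
      simp [integral_log]
      norm_num
    have hmid := midpoint_sum_le hder hmono (h.intervalIntegrable.add (hli.const_mul C)) hq
    rw [intervalIntegral.integral_add h.intervalIntegrable (hli.const_mul C),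
      intervalIntegral.integral_const_mul, hint, hlint, Finset.sum_add_distrib,
      ← Finset.mul_sum] at hmid
    have hsum : ∑ j ∈ Finset.range q, l ((j + 1 / 2) / q)
        = 2 * (q * Real.log q - ∑ j ∈ Finset.range q, Real.log (j + 1 / 2)) := by
      simp only [hl]
      rw [Finset.sum_sub_distrib, Finset.sum_neg_distrib, sum_one_sub_cell Real.log,
        show (1 : ℝ) - 1 / 2 = 1 / 2 by norm_num, sum_log_cell q hq (by norm_num)]
      ring
    rw [hsum] at hmid
    have := hD q hq
    nlinarith
  obtain ⟨C1, h1⟩ := upper h hint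
  obtain ⟨C2, h2⟩ := upper h.neg (by simpa using hint)
  refine ⟨max C1 C2, fun q hq => abs_le'.2 ⟨(h1 q hq).trans (le_max_left _ _), ?_⟩⟩
  have := h2 q hq
  rw [Finset.sum_neg_distrib] at this
  exact this.trans (le_max_right _ _)

/-! ### Drift across a cell caused by asymmetry -/

theorem log_sub_log_le_of_mul_le {x y z w : ℝ} (hx : 0 < x) (hy : 0 < y) (hz : 0 < z) (hw : 0 < w)
    (h : y * z ≤ x * w) : Real.log y - Real.log x ≤ Real.log w - Real.log z := by
  have := Real.log_le_log (by positivity) h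
  rw [Real.log_mul hy.ne' hz.ne', Real.log_mul hx.ne' hw.ne'] at this
  linarith

/-- The sum of the increments of `log` over the third quarters of the unit cells. -/
noncomputable def quarterSum (q : ℕ) : ℝ :=
  ∑ j ∈ Finset.range q, (Real.log (j + 3 / 4) - Real.log (j + 1 / 2))

/-- The sum of the increments of `log` over the second quarters of the unit cells. -/
noncomputable def quarterSum' (q : ℕ) : ℝ :=
  ∑ j ∈ Finset.range q, (Real.log (j + 1 / 2) - Real.log (j + 1 / 4))

theorem quarterSum_le_quarterSum' (q : ℕ) : quarterSum q ≤ quarterSum' q := by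
  refine Finset.sum_le_sum fun j _ => log_sub_log_le_of_mul_le (by positivity) (by positivity)
    (by positivity) (by positivity) ?_
  nlinarith

/-- By concavity of `log`, the increment over the second quarter of cell `j + 1` is at most the one
over the third quarter of cell `j`. Only the first cell is left over, with `log (1/2) - log (1/4) =
log 2`. The two quarter sums thus agree up to a bounded error, so only the difference of their
coefficients matters. -/
theorem quarterSum'_le (q : ℕ) : quarterSum' q ≤ quarterSum q + Real.log 2 := by
  have step : ∀ n : ℕ, quarterSum' (n + 1) ≤ quarterSum n + Real.log 2 := by
    intro n
    unfold quarterSum' quarterSum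
    rw [Finset.sum_range_succ', add_comm, add_comm _ (Real.log 2)]
    refine add_le_add (le_of_eq ?_) (Finset.sum_le_sum fun j _ => ?_)
    · rw [← Real.log_div (by norm_num) (by norm_num)]
      norm_num
    · refine log_sub_log_le_of_mul_le (by positivity) (by positivity)
        (by positivity) (by positivity) ?_
      push_cast
      nlinarith
  cases q with
  | zero => simpa [quarterSum, quarterSum'] using Real.log_nonneg one_le_two
  | succ n =>
    refine (step n).trans (add_le_add_left ?_ _)
    unfold quarterSum
    rw [Finset.sum_range_succ]
    have := Real.log_le_log (show (0 : ℝ) < n + 1 / 2 by positivity)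
      (show (n : ℝ) + 1 / 2 ≤ n + 3 / 4 by linarith)
    linarith

/-- Each term is at least `(1/4) / (j + 3/4)`, hence at least `(log (j + 2) - log (j + 1)) / 4`,
which telescopes. -/
theorem log_le_quarterSum (q : ℕ) : 1 / 4 * Real.log q ≤ quarterSum q := by
  have key : 1 / 4 * Real.log (q + 1) ≤ quarterSum q := by
    induction q with
    | zero => simp [quarterSum]
    | succ n ih =>
      unfold quarterSum at ih ⊢
      rw [Finset.sum_range_succ]
      have h0 : (0 : ℝ) ≤ n := Nat.cast_nonneg n
      have h1 := Real.one_sub_inv_le_log_of_pos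
        (show (0 : ℝ) < (n + 3 / 4) / (n + 1 / 2) by positivity)
      rw [Real.log_div (by positivity) (by positivity)] at h1
      have h2 := Real.log_le_sub_one_of_pos (show (0 : ℝ) < (n + 1 + 1) / (n + 1) by positivity)
      rw [Real.log_div (by positivity) (by positivity)] at h2
      have h3 : 1 / 4 * (((n : ℝ) + 1 + 1) / (n + 1) - 1) ≤ 1 - (((n : ℝ) + 3 / 4) / (n + 1 / 2))⁻¹ := by
        rw [inv_div, show (1 : ℝ) - (n + 1 / 2) / (n + 3 / 4) = (1 / 4) / (n + 3 / 4) by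
          field_simp; ring, show 1 / 4 * (((n : ℝ) + 1 + 1) / (n + 1) - 1) = (1 / 4) / (n + 1) by
          field_simp; ring]
        gcongr
        norm_num
      push_cast
      linarith
  refine le_trans ?_ key
  rcases Nat.eq_zero_or_pos q with rfl | hq
  · simp
  · have := Real.log_le_log (Nat.cast_pos.2 hq) (show (q : ℝ) ≤ q + 1 by linarith)
    linarith

theorem sum_log_cell_sub (q : ℕ) (hq : 0 < q) {u v : ℝ} (hu : 0 < u) (hv : 0 < v) :
    ∑ j ∈ Finset.range q, (Real.log ((j + v) / q) - Real.log ((j + u) / q))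
      = ∑ j ∈ Finset.range q, (Real.log (j + v) - Real.log (j + u)) := by
  rw [Finset.sum_sub_distrib, Finset.sum_sub_distrib, sum_log_cell q hq hu, sum_log_cell q hq hv]
  ring

theorem sum_log_one_sub_cell_sub (q : ℕ) (hq : 0 < q) {u v : ℝ} (hu : u < 1) (hv : v < 1) :
    ∑ j ∈ Finset.range q, (Real.log (1 - (j + v) / q) - Real.log (1 - (j + u) / q))
      = ∑ j ∈ Finset.range q, (Real.log (j + (1 - v)) - Real.log (j + (1 - u))) := by
  rw [Finset.sum_sub_distrib, sum_one_sub_cell Real.log, sum_one_sub_cell Real.log,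
    ← Finset.sum_sub_distrib, sum_log_cell_sub q hq (by linarith) (by linarith)]

/-- From the bounded midpoint sum, moving a quarter cell to the right gains at least `(a - b)` times
a quarter sum, up to `O(1)`; moving a quarter cell to the left loses as much. -/
theorem LogProfile.exists_quarter_sum_bounds {f f₁ f₂ : ℝ → ℝ} {A B : ℝ}
    (h : LogProfile f f₁ f₂ A B) (hAB : B < A) (hint : ∫ t in (0 : ℝ)..1, f t = 0) :
    ∃ c C : ℝ, 0 < c ∧ ∀ q : ℕ, 0 < q →
      c * Real.log q - C ≤ ∑ j ∈ Finset.range q, f ((j + 3 / 4) / q) ∧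
      ∑ j ∈ Finset.range q, f ((j + 1 / 4) / q) ≤ -(c * Real.log q) + C := by
  obtain ⟨D, hD⟩ := h.exists_abs_midpoint_sum_le hint
  -- Chosen so that `B < b < a < A`, which leaves the drift coefficient `a - b = (A - B) / 2`
  -- positive.
  set a := (3 * A + B) / 4 with ha
  set b := (A + 3 * B) / 4 with hb
  obtain ⟨e, he⟩ := h.exists_increment_lower_bound (b := b) (a := a) (by linarith) (by linarith)
  have incr : ∀ q : ℕ, 0 < q → ∀ u v : ℝ, 0 < u → u ≤ v → v < 1 →
      e * (v - u) - b * ∑ j ∈ Finset.range q, (Real.log (j + v) - Real.log (j + u))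
        + a * ∑ j ∈ Finset.range q, (Real.log (j + (1 - u)) - Real.log (j + (1 - v)))
        ≤ ∑ j ∈ Finset.range q, f ((j + v) / q) - ∑ j ∈ Finset.range q, f ((j + u) / q) := by
    intro q hq u v hu huv hv
    have hq' : (0 : ℝ) < q := Nat.cast_pos.2 hq
    rw [← Finset.sum_sub_distrib, ← sum_log_cell_sub q hq hu (by linarith),
      ← sum_log_one_sub_cell_sub q hq hv (by linarith), Finset.mul_sum, Finset.mul_sum]
    have hconst : e * (v - u) = ∑ j ∈ Finset.range q, e * ((j + v) / q - (j + u) / q) := by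
      have : ∀ j ∈ Finset.range q, e * (((j : ℝ) + v) / q - (j + u) / q) = e * ((v - u) / q) := by
        intro j _; ring
      rw [Finset.sum_congr rfl this, Finset.sum_const, Finset.card_range, nsmul_eq_mul]
      field_simp
    rw [hconst, ← Finset.sum_sub_distrib, ← Finset.sum_add_distrib]
    refine Finset.sum_le_sum fun j hj => he _ _ (by positivity) (by gcongr) ?_
    have h1 : (j : ℝ) + 1 ≤ q := by exact_mod_cast Finset.mem_range.1 hj
    rw [div_lt_one hq']
    linarith
  refine ⟨(A - B) / 8, D + |e| + |a| * Real.log 2 + |b| * Real.log 2, by linarith,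
    fun q hq => ?_⟩
  have hmid := abs_le.1 (hD q hq)
  have i1 := incr q hq (1 / 2) (3 / 4) (by norm_num) (by norm_num) (by norm_num)
  have i2 := incr q hq (1 / 4) (1 / 2) (by norm_num) (by norm_num) (by norm_num)
  rw [show (1 : ℝ) - 1 / 2 = 1 / 2 by norm_num, show (1 : ℝ) - 3 / 4 = 1 / 4 by norm_num] at i1
  rw [show (1 : ℝ) - 1 / 2 = 1 / 2 by norm_num, show (1 : ℝ) - 1 / 4 = 3 / 4 by norm_num] at i2
  change _ - b * quarterSum q + a * quarterSum' q ≤ _ at i1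
  change _ - b * quarterSum' q + a * quarterSum q ≤ _ at i2
  have hP := log_le_quarterSum q
  have hPR := quarterSum_le_quarterSum' q
  have hRP := quarterSum'_le q
  have hlog2 : 0 ≤ Real.log 2 := Real.log_nonneg one_le_two
  have hPR' : |quarterSum' q - quarterSum q| ≤ Real.log 2 := abs_le.2 ⟨by linarith, by linarith⟩
  have ea : -(|a| * Real.log 2) ≤ a * (quarterSum' q - quarterSum q) := by
    have := neg_abs_le (a * (quarterSum' q - quarterSum q))
    rw [abs_mul] at this
    have := mul_le_mul_of_nonneg_left hPR' (abs_nonneg a)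
    linarith
  have eb : b * (quarterSum' q - quarterSum q) ≤ |b| * Real.log 2 := by
    have := le_abs_self (b * (quarterSum' q - quarterSum q))
    rw [abs_mul] at this
    have := mul_le_mul_of_nonneg_left hPR' (abs_nonneg b)
    linarith
  have ee := neg_abs_le e
  have ee' := abs_nonneg e
  have hab : (A - B) / 8 * Real.log q ≤ (a - b) * quarterSum q := by
    rw [show a - b = (A - B) / 2 by rw [ha, hb]; ring]
    nlinarith
  have na := mul_nonneg (abs_nonneg a) hlog2
  have nb := mul_nonneg (abs_nonneg b) hlog2
  constructor
  · nlinarith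
  · nlinarith

/-! ### Birkhoff sums at denominators of good approximations -/

/-- The Birkhoff sum `∑_{j < q} f (x + j α)` of `f` along the translation by `α` on `ℝ`. -/
noncomputable def rotationSum (f : ℝ → ℝ) (α : ℝ) (q : ℕ) (x : ℝ) : ℝ :=
  ∑ j ∈ Finset.range q, f (x + j * α)

theorem logit_cell_sub_le {q s : ℕ} (hs : s < q) {u v : ℝ} (hu : 1 / 16 ≤ u) (huv : u ≤ v)
    (hv : v ≤ 15 / 16) :
    logit ((s + v) / q) - logit ((s + u) / q)
      ≤ 16 * (v - u) * (1 / ((s : ℝ) + 1) + 1 / (((q - 1 - s : ℕ) : ℝ) + 1)) := by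
  have hq' : (0 : ℝ) < q := Nat.cast_pos.2 (by omega)
  have aux : ∀ {n : ℕ} {x y : ℝ}, 1 / 16 ≤ x → x ≤ y →
      Real.log ((n + y) / q) - Real.log ((n + x) / q) ≤ 16 * (y - x) * (1 / ((n : ℝ) + 1)) := by
    intro n x y hx hxy
    have hn : (0 : ℝ) ≤ n := Nat.cast_nonneg n
    have h1 : (0 : ℝ) < n + x := by linarith
    have h2 : (0 : ℝ) < n + y := by linarith
    rw [Real.log_div h2.ne' hq'.ne', Real.log_div h1.ne' hq'.ne', sub_sub_sub_cancel_right,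
      ← Real.log_div h2.ne' h1.ne']
    refine (Real.log_le_sub_one_of_pos (by positivity)).trans ?_
    rw [show (n + y) / (n + x) - 1 = (y - x) / (n + x) by field_simp; ring, mul_one_div,
      div_le_div_iff₀ h1 (by positivity)]
    nlinarith [mul_nonneg (sub_nonneg.2 hxy) hn]
  unfold logit
  rw [one_sub_cell hs, one_sub_cell hs]
  have h1 := aux (n := s) hu huv
  have h2 := aux (n := q - 1 - s) (x := 1 - v) (y := 1 - u) (by linarith) (by linarith)
  rw [show 1 - u - (1 - v) = v - u by ring] at h2
  linarith

theorem sum_one_div_succ_le (q : ℕ) :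
    ∑ s ∈ Finset.range q, 1 / ((s : ℝ) + 1) ≤ 1 + Real.log q := by
  have := harmonic_le_one_add_log q
  simpa [harmonic] using this

/-- Away from the cell ends, moving a point of cell `s` by `κ / q` changes `f` by `O(κ)` times
`1/(s+1) + 1/(q-s)`. Since `σ` visits each cell once, summation gives harmonic sums, hence `log q`.
The lemma serves both to replace the orbit by a grid and to bound the slope of the Birkhoff sum. -/
theorem LogProfile.exists_sum_cell_sub_le {f f₁ f₂ : ℝ → ℝ} {A B : ℝ}
    (h : LogProfile f f₁ f₂ A B) :
    ∃ C, 0 < C ∧ ∀ (q : ℕ) (σ : ℕ → ℕ) (u v : ℕ → ℝ) (κ : ℝ), 0 < q → (∀ j < q, σ j < q) →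
      (∀ w : ℕ → ℝ, ∑ j ∈ Finset.range q, w (σ j) = ∑ s ∈ Finset.range q, w s) →
      (∀ j < q, 1 / 16 ≤ u j ∧ u j ≤ 15 / 16) → (∀ j < q, 1 / 16 ≤ v j ∧ v j ≤ 15 / 16) →
      (∀ j < q, |u j - v j| ≤ κ) →
      |∑ j ∈ Finset.range q, f ((σ j + u j) / q) - ∑ j ∈ Finset.range q, f ((σ j + v j) / q)|
        ≤ C * κ * (1 + Real.log q) := by
  obtain ⟨C, hC, hf⟩ := h.exists_abs_increment_le
  refine ⟨32 * C, by positivity, fun q σ u v κ hq hσ hsum hu hv huv => ?_⟩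
  have hκ : 0 ≤ κ := (abs_nonneg _).trans (huv 0 hq)
  have hq' : (0 : ℝ) < q := Nat.cast_pos.2 hq
  have term : ∀ s < q, ∀ x y : ℝ, 1 / 16 ≤ x → x ≤ y → y ≤ 15 / 16 → |x - y| ≤ κ →
      |f ((s + y) / q) - f ((s + x) / q)|
        ≤ C * (16 * κ) * (1 / ((s : ℝ) + 1) + 1 / (((q - 1 - s : ℕ) : ℝ) + 1)) := by
    intro s hs x y hx hxy hy hxyκ
    have h1 : (s : ℝ) + 1 ≤ q := by exact_mod_cast hs
    have h2 := hf ((s + x) / q) ((s + y) / q) (by positivity) (by gcongr)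
      (by rw [div_lt_one hq']; linarith)
    rw [abs_sub_comm, abs_of_nonneg (sub_nonneg.2 hxy)] at hxyκ
    refine h2.trans ?_
    rw [mul_assoc]
    refine mul_le_mul_of_nonneg_left ((logit_cell_sub_le hs hx hxy hy).trans ?_) hC.le
    gcongr
  rw [← Finset.sum_sub_distrib]
  refine (Finset.abs_sum_le_sum_abs _ _).trans ?_
  have hle : ∀ j ∈ Finset.range q, |f ((σ j + u j) / q) - f ((σ j + v j) / q)|
      ≤ C * (16 * κ) * (1 / ((σ j : ℝ) + 1) + 1 / (((q - 1 - σ j : ℕ) : ℝ) + 1)) := by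
    intro j hj
    have hj := Finset.mem_range.1 hj
    rcases le_total (u j) (v j) with h1 | h1
    · rw [abs_sub_comm]
      exact term _ (hσ j hj) _ _ (hu j hj).1 h1 (hv j hj).2 (huv j hj)
    · exact term _ (hσ j hj) _ _ (hv j hj).1 h1 (hu j hj).2 (by rw [abs_sub_comm]; exact huv j hj)
  refine (Finset.sum_le_sum hle).trans ?_
  rw [← Finset.mul_sum,
    hsum (fun s => 1 / ((s : ℝ) + 1) + 1 / (((q - 1 - s : ℕ) : ℝ) + 1)), Finset.sum_add_distrib,
    Finset.sum_range_reflect (fun s : ℕ => 1 / ((s : ℝ) + 1)) q]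
  have h1 := sum_one_div_succ_le q
  have h2 : 0 ≤ C * (16 * κ) := by positivity
  nlinarith [mul_le_mul_of_nonneg_left h1 h2]

theorem sum_emod_eq {q : ℕ} (hq : 0 < q) {p : ℤ} (hp : IsCoprime p (q : ℤ)) (i : ℤ) (w : ℕ → ℝ) :
    ∑ j ∈ Finset.range q, w ((i + j * p) % q).toNat = ∑ s ∈ Finset.range q, w s := by
  have hq' : (q : ℤ) ≠ 0 := by exact_mod_cast hq.ne'
  have hmaps : ∀ j ∈ Finset.range q, ((i + j * p) % q).toNat ∈ Finset.range q := by
    intro j _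
    have h1 := Int.emod_nonneg (i + j * p) hq'
    have h2 := Int.emod_lt_of_pos (i + j * p) (b := q) (by exact_mod_cast hq)
    rw [Finset.mem_range]
    omega
  have hinj : Set.InjOn (fun j : ℕ => ((i + j * p) % q).toNat) (Finset.range q) := by
    intro a ha b hb hab
    have ha := Finset.mem_range.1 (Finset.mem_coe.1 ha)
    have hb := Finset.mem_range.1 (Finset.mem_coe.1 hb)
    simp only at hab
    have h1 := Int.emod_nonneg (i + a * p) hq'
    have h2 := Int.emod_nonneg (i + b * p) hq'
    have h3 : (i + a * p) % q = (i + b * p) % q := by omega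
    have h4 : (q : ℤ) ∣ (b - a) * p := by
      have := Int.ModEq.dvd h3
      rwa [add_sub_add_left_eq_sub, ← sub_mul] at this
    have h5 : (q : ℤ) ∣ b - a := hp.symm.dvd_of_dvd_mul_right h4
    have h6 := Int.eq_zero_of_abs_lt_dvd h5 (abs_lt.2 ⟨by omega, by omega⟩)
    omega
  have himage : (Finset.range q).image (fun j : ℕ => ((i + j * p) % q).toNat) = Finset.range q :=
    Finset.eq_of_subset_of_card_le (Finset.image_subset_iff.2 hmaps)
      (by rw [Finset.card_image_of_injOn hinj])
  conv_rhs => rw [← himage]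
  rw [Finset.sum_image hinj]

/-- Modulo `1`, the point `t + jα` lies near cell `i + jp mod q`. Its offset is that of `t` from
cell `i`, plus the drift `q j (α - p/q)` due to the approximation error. -/
theorem rotationSum_eq_cell {f : ℝ → ℝ} (hper : Function.Periodic f 1) {x : ℚ} (α : ℝ) (i : ℤ)
    (t : ℝ) :
    rotationSum f α x.den t = ∑ j ∈ Finset.range x.den,
      f (((((i + j * x.num) % x.den).toNat : ℕ)
        + (x.den * t - i + x.den * (j * (α - x)))) / x.den) := by
  refine Finset.sum_congr rfl fun j _ => ?_
  have hq : (x.den : ℤ) ≠ 0 := by exact_mod_cast x.den_nz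
  have hq' : (x.den : ℝ) ≠ 0 := by exact_mod_cast x.den_nz
  have h1 : ((((i + j * x.num) % x.den).toNat : ℕ) : ℝ)
      = i + j * x.num - x.den * ((i + j * x.num) / x.den : ℤ) := by
    have h2 : ((((i + j * x.num) % x.den).toNat : ℕ) : ℤ)
        = i + j * x.num - x.den * ((i + j * x.num) / x.den) := by
      rw [Int.toNat_of_nonneg (Int.emod_nonneg _ hq), Int.emod_def]
    exact_mod_cast congrArg (Int.cast : ℤ → ℝ) h2
  have hx : (x : ℝ) * x.den = x.num := by exact_mod_cast Rat.mul_den_eq_num x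
  rw [h1]
  have : (i + j * x.num - x.den * ((i + j * x.num) / x.den : ℤ)
      + (x.den * t - i + x.den * (j * (α - x)))) / x.den
      = t + j * α - ((i + j * x.num) / x.den : ℤ) * 1 := by
    rw [← hx]
    field_simp
    ring
  rw [this, hper.sub_int_mul_eq]

theorem LogProfile.exists_level_points_of_lt {f f₁ f₂ : ℝ → ℝ} {A B : ℝ}
    (h : LogProfile f f₁ f₂ A B) (hAB : B < A) (hper : Function.Periodic f 1)
    (hint : ∫ t in (0 : ℝ)..1, f t = 0) :
    ∃ K C : ℝ, 0 < K ∧ 0 < C ∧ ∀ r : ℝ, ∃ Q : ℕ, ∀ (x : ℚ) (α : ℝ), Q ≤ x.den →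
      |α - x| ≤ 1 / (K * x.den ^ 2) → ∀ i : ℤ, ∃ z : ℝ,
        (i + 1 / 4) / x.den ≤ z ∧ z ≤ (i + 3 / 4) / x.den ∧
        ∀ ε : ℝ, ε ≤ 1 → ∀ t : ℝ, |t - z| ≤ ε / (C * x.den * Real.log x.den) →
          |rotationSum f α x.den t - r| ≤ ε := by
  obtain ⟨c, D, hc, hquarter⟩ := h.exists_quarter_sum_bounds hAB hint
  obtain ⟨E, hE, hcell⟩ := h.exists_sum_cell_sub_le
  -- The drift of offsets is at most `κ = 1/K`. The `16` keeps offsets from `[1/8, 7/8]` inside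
  -- `[1/16, 15/16]`, and `4 E / c` makes the perturbation cost at most a quarter of the drift `c
  -- log q`. In the slope constant, `2 E` dominates `E (1 + log q) / log q` and `8` keeps `t` within
  -- `1/8` of a cell from `z`.
  refine ⟨16 + 4 * E / c, 2 * E + 8, by positivity, by positivity, fun r => ?_⟩
  obtain ⟨Q, hQ⟩ := (((Real.tendsto_log_atTop.comp tendsto_natCast_atTop_atTop).eventually_ge_atTop
    (4 / c * (D + |r|))).and (eventually_ge_atTop 3)).exists_forall_of_atTop
  refine ⟨Q, fun x α hxQ hα i => ?_⟩
  set q := x.den with hqdef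
  obtain ⟨hlog, hq3⟩ := hQ q hxQ
  simp only [Function.comp] at hlog
  have hq : 0 < q := by omega
  have hq' : (0 : ℝ) < q := Nat.cast_pos.2 hq
  have hlog1 : 1 ≤ Real.log q := by
    rw [Real.le_log_iff_exp_le hq']
    have : (3 : ℝ) ≤ q := by exact_mod_cast hq3
    linarith [Real.exp_one_lt_three]
  set κ : ℝ := 1 / (16 + 4 * E / c) with hκ
  have hκ0 : 0 < κ := by positivity
  have hκ16 : κ ≤ 1 / 16 := by
    rw [hκ]
    exact one_div_le_one_div_of_le (by norm_num) (le_add_of_nonneg_right (by positivity))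
  have hEκ : E * κ ≤ c / 4 := by
    rw [hκ, mul_one_div, div_le_iff₀ (by positivity)]
    have : c / 4 * (16 + 4 * E / c) = 4 * c + E := by field_simp; ring
    linarith
  set σ : ℕ → ℕ := fun j => ((i + j * x.num) % q).toNat with hσdef
  have hσ : ∀ j < q, σ j < q := by
    intro j _
    have h1 := Int.emod_nonneg (i + j * x.num) (b := (q : ℤ)) (by omega)
    have h2 := Int.emod_lt_of_pos (i + j * x.num) (b := (q : ℤ)) (by omega)
    simp only [hσdef]
    omega
  have hcop : IsCoprime x.num (q : ℤ) := by
    rw [Int.isCoprime_iff_gcd_eq_one]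
    exact x.reduced
  have hσsum : ∀ w : ℕ → ℝ, ∑ j ∈ Finset.range q, w (σ j) = ∑ s ∈ Finset.range q, w s :=
    sum_emod_eq hq hcop i
  have hθ : ∀ j < q, |q * (j * (α - x))| ≤ κ := by
    intro j hj
    have hj' : (j : ℝ) ≤ q := by exact_mod_cast hj.le
    rw [abs_mul, abs_mul, Nat.abs_cast, Nat.abs_cast]
    calc (q : ℝ) * (j * |α - x|) ≤ q * (q * (1 / ((16 + 4 * E / c) * q ^ 2))) := by gcongr
      _ = κ := by rw [hκ]; field_simp
  have hS : ∀ t : ℝ, rotationSum f α q t = ∑ j ∈ Finset.range q,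
      f ((σ j + (q * t - i + q * (j * (α - x)))) / q) := rotationSum_eq_cell hper α i
  have hlip : ∀ s t : ℝ, 1 / 8 ≤ q * s - i → q * s - i ≤ 7 / 8 → 1 / 8 ≤ q * t - i →
      q * t - i ≤ 7 / 8 →
      |rotationSum f α q s - rotationSum f α q t| ≤ E * (q * |s - t|) * (1 + Real.log q) := by
    intro s t hs0 hs1 ht0 ht1
    rw [hS s, hS t]
    refine hcell q σ _ _ _ hq hσ hσsum ?_ ?_ ?_
    · intro j hj
      have := abs_le.1 (hθ j hj)
      constructor <;> linarith
    · intro j hj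
      have := abs_le.1 (hθ j hj)
      constructor <;> linarith
    · intro j _
      rw [show (q : ℝ) * s - i + q * (j * (α - x)) - (q * t - i + q * (j * (α - x)))
        = q * (s - t) by ring, abs_mul, Nat.abs_cast]
  have hpert : ∀ u : ℝ, 1 / 8 ≤ u → u ≤ 7 / 8 →
      |rotationSum f α q ((i + u) / q) - ∑ j ∈ Finset.range q, f ((j + u) / q)|
        ≤ c / 4 * (1 + Real.log q) := by
    intro u hu0 hu1
    rw [hS, ← hσsum (fun j => f ((j + u) / q)),
      show (q : ℝ) * ((i + u) / q) - i = u by field_simp; ring]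
    refine (hcell q σ _ _ κ hq hσ hσsum ?_ ?_ ?_).trans ?_
    · intro j hj
      have := abs_le.1 (hθ j hj)
      constructor <;> linarith
    · intro j hj
      constructor <;> linarith
    · intro j hj
      rw [add_sub_cancel_left]
      exact hθ j hj
    · have : 0 ≤ 1 + Real.log q := by linarith
      exact mul_le_mul_of_nonneg_right hEκ this
  have hcont : ContinuousOn (rotationSum f α q) (Set.Icc ((i + 1 / 4) / q) ((i + 3 / 4) / q)) := by
    refine (LipschitzOnWith.of_dist_le_mul (K := ⟨E * q * (1 + Real.log q), by positivity⟩)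
      fun s hs t ht => ?_).continuousOn
    have h1 := (div_le_iff₀ hq').1 hs.1
    have h2 := (le_div_iff₀ hq').1 hs.2
    have h3 := (div_le_iff₀ hq').1 ht.1
    have h4 := (le_div_iff₀ hq').1 ht.2
    have := hlip s t (by linarith) (by linarith) (by linarith) (by linarith)
    rw [Real.dist_eq, Real.dist_eq]
    refine this.trans (le_of_eq ?_)
    change _ = E * q * (1 + Real.log q) * |s - t|
    ring
  have hDr : D + |r| ≤ c / 4 * Real.log q := by
    have := mul_le_mul_of_nonneg_left hlog (show 0 ≤ c / 4 by positivity)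
    have e : c / 4 * (4 / c * (D + |r|)) = D + |r| := by field_simp
    linarith
  have hq1 := hquarter q hq
  have hlow : rotationSum f α q ((i + 1 / 4) / q) ≤ r := by
    have h1 := (abs_le.1 (hpert (1 / 4) (by norm_num) (by norm_num))).2
    have h2 := neg_abs_le r
    nlinarith [hq1.2]
  have hhigh : r ≤ rotationSum f α q ((i + 3 / 4) / q) := by
    have h1 := (abs_le.1 (hpert (3 / 4) (by norm_num) (by norm_num))).1
    have h2 := le_abs_self r
    nlinarith [hq1.1]
  -- The sum is at most `r` at the first quarter point and at least `r` at the third, so the level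
  -- is attained between them.
  obtain ⟨z, hz, hzr⟩ := intermediate_value_Icc (by gcongr; norm_num) hcont ⟨hlow, hhigh⟩
  refine ⟨z, hz.1, hz.2, fun ε hε t ht => ?_⟩
  have h1 := (div_le_iff₀ hq').1 hz.1
  have h2 := (le_div_iff₀ hq').1 hz.2
  have ht' : q * |t - z| * ((2 * E + 8) * Real.log q) ≤ ε := by
    rw [le_div_iff₀ (by positivity)] at ht
    linarith
  have h3 : q * |t - z| ≤ 1 / 8 := by
    have h4 : 0 ≤ q * |t - z| := by positivity
    have h5 : 8 ≤ (2 * E + 8) * Real.log q := by nlinarith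
    nlinarith
  have h4 : |q * (t - z)| ≤ 1 / 8 := by rwa [abs_mul, Nat.abs_cast]
  have h5 := abs_le.1 h4
  rw [← hzr]
  refine (hlip t z (by linarith) (by linarith) (by linarith) (by linarith)).trans (le_trans ?_ ht')
  have h6 : 0 ≤ q * |t - z| := by positivity
  have h7 : E * (1 + Real.log q) ≤ (2 * E + 8) * Real.log q := by nlinarith
  nlinarith [mul_le_mul_of_nonneg_left h7 h6]

/-- For an asymmetric logarithmic profile, the Birkhoff sums at denominators of good rational
approximations of the rotation number attain every level in every cell, with a controlled slope. -/
theorem LogProfile.exists_level_points {f f₁ f₂ : ℝ → ℝ} {A B : ℝ}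
    (h : LogProfile f f₁ f₂ A B) (hAB : A ≠ B) (hper : Function.Periodic f 1)
    (hint : ∫ t in (0 : ℝ)..1, f t = 0) :
    ∃ K C : ℝ, 0 < K ∧ 0 < C ∧ ∀ r : ℝ, ∃ Q : ℕ, ∀ (x : ℚ) (α : ℝ), Q ≤ x.den →
      |α - x| ≤ 1 / (K * x.den ^ 2) → ∀ i : ℤ, ∃ z : ℝ,
        (i + 1 / 4) / x.den ≤ z ∧ z ≤ (i + 3 / 4) / x.den ∧
        ∀ ε : ℝ, ε ≤ 1 → ∀ t : ℝ, |t - z| ≤ ε / (C * x.den * Real.log x.den) →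
          |rotationSum f α x.den t - r| ≤ ε := by
  rcases lt_or_gt_of_ne hAB with hlt | hlt
  -- When `A < B`, pass to `-f` and to the level `-r`.
  · obtain ⟨K, C, hK, hC, H⟩ := h.neg.exists_level_points_of_lt (neg_lt_neg hlt)
      (fun t => by simp only [hper t]) (by simpa using hint)
    refine ⟨K, C, hK, hC, fun r => ?_⟩
    obtain ⟨Q, hQ⟩ := H (-r)
    refine ⟨Q, fun x α hx hα i => ?_⟩
    obtain ⟨z, hz1, hz2, hz⟩ := hQ x α hx hα i
    refine ⟨z, hz1, hz2, fun ε hε t ht => ?_⟩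
    have h1 := hz ε hε t ht
    have h2 : rotationSum (fun t => -f t) α x.den t = -rotationSum f α x.den t := by
      simp [rotationSum]
    rwa [h2, ← neg_add', abs_neg, ← sub_eq_add_neg] at h1
  · exact h.exists_level_points_of_lt hlt hper hint

/-! ### Density points and approximation at many scales -/

/-- A density point of `D`. It is used on `ℝ`, and on `ℝ × ℝ`, where the sup norm makes the ball a
square. -/
theorem exists_closedBall_diff_le {E : Type*} [NormedAddCommGroup E] [NormedSpace ℝ E]
    [FiniteDimensional ℝ E] [MeasurableSpace E] [BorelSpace E] (μ : Measure E)
    [IsLocallyFiniteMeasure μ] [μ.IsOpenPosMeasure] [SFinite μ] {D : Set E} (hDm : MeasurableSet D)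
    (hD : μ D ≠ 0) {δ : ENNReal} (hδ : δ ≠ 0) {r₀ : ℝ} (hr₀ : 0 < r₀) :
    ∃ x, ∃ r, 0 < r ∧ r < r₀ ∧
      μ (Metric.closedBall x r \ D) ≤ δ * μ (Metric.closedBall x r) := by
  have : ProperSpace E := FiniteDimensional.proper ℝ E
  have h := Besicovitch.ae_tendsto_measure_inter_div μ D
  have hne : NeBot (ae (μ.restrict D)) := by
    rw [ae_neBot]
    exact fun h0 => hD (Measure.restrict_eq_zero.1 h0)
  obtain ⟨x, hx⟩ := h.exists
  have hlt : ∀ᶠ r in 𝓝[>] (0 : ℝ), 1 - δ < μ (D ∩ Metric.closedBall x r) /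
      μ (Metric.closedBall x r) :=
    hx.eventually_const_lt (ENNReal.sub_lt_self ENNReal.one_ne_top one_ne_zero hδ)
  obtain ⟨r, hr1, hr2⟩ := (hlt.and (Ioo_mem_nhdsGT hr₀)).exists
  refine ⟨x, r, hr2.1, hr2.2, ?_⟩
  have hfin : μ (Metric.closedBall x r) ≠ ⊤ := (isCompact_closedBall x r).measure_lt_top.ne
  have hpos : μ (Metric.closedBall x r) ≠ 0 := (Metric.measure_closedBall_pos μ x hr2.1).ne'
  have h1 : (1 - δ) * μ (Metric.closedBall x r) ≤ μ (D ∩ Metric.closedBall x r) := by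
    rw [← ENNReal.le_div_iff_mul_le (Or.inl hpos) (Or.inl hfin)]
    exact hr1.le
  have h2 := measure_inter_add_sdiff (μ := μ) (Metric.closedBall x r) hDm
  rw [Set.inter_comm] at h2
  have h3 : μ (Metric.closedBall x r)
      ≤ δ * μ (Metric.closedBall x r) + (1 - δ) * μ (Metric.closedBall x r) := by
    rw [← add_mul]
    refine le_mul_of_one_le_left zero_le ?_
    rw [add_comm]
    exact le_tsub_add
  have h4 : μ (D ∩ Metric.closedBall x r) ≠ ⊤ :=
    ((measure_mono Set.inter_subset_right).trans_lt hfin.lt_top).ne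
  rw [← ENNReal.add_le_add_iff_left h4, h2, add_comm]
  exact h3.trans (add_le_add_right h1 _)

/-- The reals admitting a reduced rational approximation of quality `1 / (K q²)` whose denominator
`q` lies in `[2 ^ m, 2 ^ (m + 4))`. -/
def goodScale (K : ℝ) (m : ℕ) : Set ℝ :=
  {α | ∃ x : ℚ, 2 ^ m ≤ x.den ∧ x.den < 2 ^ (m + 4) ∧ |α - x| ≤ 1 / (K * x.den ^ 2)}

theorem measurableSet_goodScale (K : ℝ) (m : ℕ) : MeasurableSet (goodScale K m) := by
  have : goodScale K m = ⋃ x ∈ {x : ℚ | 2 ^ m ≤ x.den ∧ x.den < 2 ^ (m + 4)},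
      Metric.closedBall (x : ℝ) (1 / (K * x.den ^ 2)) := by
    ext α
    simp only [goodScale, Set.mem_ofPred_eq, Set.mem_iUnion, Metric.mem_closedBall, Real.dist_eq,
      exists_prop, and_assoc]
  rw [this]
  exact MeasurableSet.biUnion (Set.to_countable _) fun x _ => Metric.isClosed_closedBall.measurableSet

theorem card_int_le {s : Finset ℤ} {a b : ℝ} (hab : a ≤ b) (h : ∀ i ∈ s, a ≤ i ∧ i ≤ b) :
    (s.card : ℝ) ≤ b - a + 1 := by
  have hsub : s ⊆ Finset.Icc ⌈a⌉ ⌊b⌋ := fun i hi =>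
    Finset.mem_Icc.2 ⟨Int.ceil_le.2 (h i hi).1, Int.le_floor.2 (h i hi).2⟩
  have h1 : (s.card : ℝ) ≤ ((⌊b⌋ + 1 - ⌈a⌉).toNat : ℕ) := by
    exact_mod_cast (Finset.card_le_card hsub).trans_eq (Int.card_Icc _ _)
  have h2 : (((⌊b⌋ + 1 - ⌈a⌉).toNat : ℕ) : ℝ) = max ((⌊b⌋ : ℝ) + 1 - ⌈a⌉) 0 := by
    exact_mod_cast congrArg (Int.cast : ℤ → ℝ) (Int.toNat_eq_max (⌊b⌋ + 1 - ⌈a⌉))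
  refine h1.trans (h2.trans_le (max_le ?_ (by linarith)))
  linarith [Int.floor_le b, Int.le_ceil a]

theorem volume_near_fractions_le (y : ℝ) {ρ δ : ℝ} (hρ : 0 ≤ ρ) (hδ : 0 ≤ δ) {q : ℕ} (hq : 0 < q)
    (hqδ : q * δ ≤ 1) :
    volume {α | α ∈ Metric.closedBall y ρ ∧ ∃ p : ℤ, |α - p / q| ≤ δ}
      ≤ ENNReal.ofReal ((2 * ρ * q + 3) * (2 * δ)) := by
  have hq' : (0 : ℝ) < q := Nat.cast_pos.2 hq
  set s := Finset.Icc ⌈q * (y - ρ - δ)⌉ ⌊q * (y + ρ + δ)⌋ with hs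
  have hsub : {α | α ∈ Metric.closedBall y ρ ∧ ∃ p : ℤ, |α - p / q| ≤ δ}
      ⊆ ⋃ p ∈ s, Metric.closedBall ((p : ℝ) / q) δ := by
    rintro α ⟨hα, p, hp⟩
    simp only [Set.mem_iUnion, Metric.mem_closedBall, Real.dist_eq, exists_prop] at hα ⊢
    refine ⟨p, ?_, hp⟩
    rw [abs_le] at hα hp
    rw [hs, Finset.mem_Icc, Int.ceil_le, Int.le_floor]
    have e : (p : ℝ) = q * (p / q) := by field_simp
    constructor
    · rw [e]
      exact mul_le_mul_of_nonneg_left (by linarith) hq'.le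
    · rw [e]
      exact mul_le_mul_of_nonneg_left (by linarith) hq'.le
  have hcard : (s.card : ℝ) ≤ 2 * ρ * q + 3 := by
    refine (card_int_le (a := q * (y - ρ - δ)) (b := q * (y + ρ + δ))
      (mul_le_mul_of_nonneg_left (by linarith) hq'.le) fun p hp => ?_).trans (by linarith)
    rwa [hs, Finset.mem_Icc, Int.ceil_le, Int.le_floor] at hp
  calc _ ≤ _ := measure_mono hsub
    _ ≤ ∑ p ∈ s, volume (Metric.closedBall ((p : ℝ) / q) δ) := measure_biUnion_finset_le _ _
    _ = s.card * ENNReal.ofReal (2 * δ) := by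
        simp [Real.volume_closedBall]
    _ = ENNReal.ofReal (s.card * (2 * δ)) := by
        rw [ENNReal.ofReal_mul (Nat.cast_nonneg _), ENNReal.ofReal_natCast]
    _ ≤ _ := ENNReal.ofReal_le_ofReal (mul_le_mul_of_nonneg_right hcard (by positivity))

/-- The points of a ball whose Dirichlet approximation of order `2 ^ (m + 4)` has denominator less
than `2 ^ m` fill at most half of the ball, for large `m`. -/
theorem volume_small_denominator_le (y : ℝ) {ρ : ℝ} (hρ : 0 < ρ) :
    ∃ m₀ : ℕ, ∀ m ≥ m₀, volume {α | α ∈ Metric.closedBall y ρ ∧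
      ∃ x : ℚ, x.den < 2 ^ m ∧ |α - x| ≤ 1 / (2 ^ (m + 4) * x.den)} ≤ ENNReal.ofReal ρ := by
  have hlim : Tendsto (fun m : ℕ => (1 + m : ℝ) / 2 ^ m) atTop (𝓝 0) := by
    have h1 := tendsto_pow_const_div_const_pow_of_one_lt 0 (show (1 : ℝ) < 2 by norm_num)
    have h2 := tendsto_pow_const_div_const_pow_of_one_lt 1 (show (1 : ℝ) < 2 by norm_num)
    have := h1.add h2
    simp only [add_zero] at this
    refine this.congr fun m => ?_
    ring
  obtain ⟨m₀, hm₀⟩ := (hlim.eventually_lt_const hρ).exists_forall_of_atTop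
  refine ⟨m₀, fun m hm => ?_⟩
  have hsmall := hm₀ m hm
  set N : ℝ := 2 ^ (m + 4) with hN
  have hNm : N = 16 * 2 ^ m := by rw [hN, pow_add]; norm_num; ring
  have hm1 : (1 : ℝ) ≤ 2 ^ m := one_le_pow₀ (by norm_num)
  have hN1 : 1 ≤ N := by rw [hNm]; linarith
  have hsub : {α | α ∈ Metric.closedBall y ρ ∧ ∃ x : ℚ, x.den < 2 ^ m ∧ |α - x| ≤ 1 / (N * x.den)}
      ⊆ ⋃ j ∈ Finset.range (2 ^ m), {α | α ∈ Metric.closedBall y ρ ∧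
          ∃ p : ℤ, |α - p / (j + 1 : ℕ)| ≤ 1 / (N * (j + 1 : ℕ))} := by
    rintro α ⟨hα, x, hx, hax⟩
    have hpos := x.den_pos
    simp only [Set.mem_iUnion, Finset.mem_range, exists_prop, Set.mem_ofPred_eq]
    refine ⟨x.den - 1, by omega, hα, x.num, ?_⟩
    rw [Nat.sub_add_cancel hpos]
    rwa [Rat.cast_def] at hax
  have hterm : ∀ j ∈ Finset.range (2 ^ m), volume {α | α ∈ Metric.closedBall y ρ ∧
          ∃ p : ℤ, |α - p / (j + 1 : ℕ)| ≤ 1 / (N * (j + 1 : ℕ))}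
        ≤ ENNReal.ofReal (4 * ρ / N + 6 / N * (1 / ((j : ℝ) + 1))) := by
    intro j _
    refine (volume_near_fractions_le y hρ.le (by positivity) (Nat.succ_pos j) ?_).trans
      (ENNReal.ofReal_le_ofReal (le_of_eq ?_))
    · push_cast
      rw [mul_one_div, div_le_one (by positivity)]
      nlinarith
    · push_cast
      field_simp
      ring
  calc _ ≤ _ := measure_mono hsub
    _ ≤ _ := measure_biUnion_finset_le _ _
    _ ≤ _ := Finset.sum_le_sum hterm
    _ = ENNReal.ofReal (∑ j ∈ Finset.range (2 ^ m),
          (4 * ρ / N + 6 / N * (1 / ((j : ℝ) + 1)))) := by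
        rw [ENNReal.ofReal_sum_of_nonneg]
        intro j _
        positivity
    _ ≤ ENNReal.ofReal ρ := by
        refine ENNReal.ofReal_le_ofReal ?_
        rw [Finset.sum_add_distrib, ← Finset.mul_sum, Finset.sum_const, Finset.card_range,
          nsmul_eq_mul]
        have h1 := sum_one_div_succ_le (2 ^ m)
        push_cast at h1 ⊢
        rw [Real.log_pow] at h1
        have h2 : m * Real.log 2 ≤ m * 1 :=
          mul_le_mul_of_nonneg_left (by linarith [Real.log_two_lt_d9]) (Nat.cast_nonneg m)
        -- Summed over denominators up to `2 ^ m`, the main terms give `ρ / 4` because `N` is `16`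
        -- times larger than `2 ^ m`; the boundary terms give a harmonic sum over `N`, which tends
        -- to `0`.
        have h3 : (2 : ℝ) ^ m * (4 * ρ / N) = ρ / 4 := by
          rw [hNm]; field_simp; norm_num
        have h4 : 6 / N * ∑ j ∈ Finset.range (2 ^ m), 1 / ((j : ℝ) + 1) ≤ 6 / N * (1 + m) :=
          mul_le_mul_of_nonneg_left (by linarith) (by positivity)
        have h5 : 6 / N * (1 + m) = 6 / 16 * ((1 + m : ℝ) / 2 ^ m) := by
          rw [hNm]; field_simp
        linarith

theorem Rat.one_div_den_mul_den_le_abs_sub {x y : ℚ} (h : x ≠ y) :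
    1 / ((x.den : ℝ) * y.den) ≤ |(x : ℝ) - y| := by
  have hx : (0 : ℝ) < x.den := Nat.cast_pos.2 x.den_pos
  have hy : (0 : ℝ) < y.den := Nat.cast_pos.2 y.den_pos
  have h1 : (x : ℝ) - y = ((x.num * y.den - y.num * x.den : ℤ) : ℝ) / (x.den * y.den) := by
    rw [Rat.cast_def x, Rat.cast_def y]
    push_cast
    field_simp
  have h2 : x.num * y.den - y.num * x.den ≠ 0 := by
    intro h0
    have h3 : (x : ℝ) - y = 0 := by rw [h1, h0]; simp
    exact h (by exact_mod_cast sub_eq_zero.1 h3)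
  rw [h1, abs_div, abs_of_pos (mul_pos hx hy)]
  gcongr
  rw [← Int.cast_abs]
  exact_mod_cast Int.one_le_abs h2

/-- By Dirichlet with `N = 2 ^ (m + 4)`, a fixed part of the ball is covered by the intervals of
radius `1 / (N q)` about fractions with `2 ^ m ≤ q < N`. Shrinking all radii to `1 / (K N²)` makes
the intervals disjoint, puts them inside `goodScale` and costs at most a factor `16 K` in measure.
-/
theorem exists_le_volume_goodScale_inter {K : ℝ} (hK : 2 ≤ K) (y : ℝ) {ρ : ℝ} (hρ : 0 < ρ) :
    ∃ m₀ : ℕ, ∀ m ≥ m₀, ENNReal.ofReal (ρ / (32 * K))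
      ≤ volume (goodScale K m ∩ Metric.closedBall y ρ) := by
  obtain ⟨m₁, hm₁⟩ := volume_small_denominator_le y (half_pos hρ)
  have hlim : Tendsto (fun m : ℕ => (1 / 2 : ℝ) ^ m) atTop (𝓝 0) :=
    tendsto_pow_atTop_nhds_zero_of_lt_one (by norm_num) (by norm_num)
  obtain ⟨m₂, hm₂⟩ := (hlim.eventually_lt_const (half_pos hρ)).exists_forall_of_atTop
  refine ⟨max m₁ m₂, fun m hm => ?_⟩
  have hbad := hm₁ m (le_of_max_le_left hm)
  have hsmall := hm₂ m (le_of_max_le_right hm)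
  have hm1 : (1 : ℝ) ≤ 2 ^ m := one_le_pow₀ (by norm_num)
  set N : ℝ := 2 ^ (m + 4) with hN
  have hNm : N = 16 * 2 ^ m := by rw [hN, pow_add]; norm_num; ring
  have hN16 : 16 ≤ N := by rw [hNm]; linarith
  have hK0 : 0 < K := by linarith
  set X : Set ℚ := {x | 2 ^ m ≤ x.den ∧ x.den < 2 ^ (m + 4) ∧
    ∃ α ∈ Metric.closedBall y (ρ / 2), |α - x| ≤ 1 / (N * x.den)} with hX
  have hXden : ∀ x ∈ X, (2 : ℝ) ^ m ≤ x.den ∧ (x.den : ℝ) < N := fun x hx =>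
    ⟨by exact_mod_cast hx.1, by rw [hN]; exact_mod_cast hx.2.1⟩
  have hcover : Metric.closedBall y (ρ / 2) ⊆ {α | α ∈ Metric.closedBall y (ρ / 2) ∧
      ∃ x : ℚ, x.den < 2 ^ m ∧ |α - x| ≤ 1 / (N * x.den)}
      ∪ ⋃ x ∈ X, Metric.closedBall (x : ℝ) (1 / (N * x.den)) := by
    intro α hα
    obtain ⟨x, hx1, hx2⟩ := Real.exists_rat_abs_sub_le_and_den_le α
      (n := 2 ^ (m + 4) - 1) (by have := Nat.one_lt_two_pow (show m + 4 ≠ 0 by omega); omega)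
    have hpow : 0 < 2 ^ (m + 4) := by positivity
    rw [Nat.cast_sub (by omega)] at hx1
    push_cast at hx1
    rw [sub_add_cancel] at hx1
    by_cases hlt : x.den < 2 ^ m
    · exact Or.inl ⟨hα, x, hlt, hx1⟩
    · refine Or.inr (Set.mem_biUnion (x := x) ⟨not_lt.1 hlt, by omega, α, hα, hx1⟩ ?_)
      rwa [Metric.mem_closedBall, Real.dist_eq]
  have hhalf : ENNReal.ofReal (ρ / 2)
      ≤ volume (⋃ x ∈ X, Metric.closedBall (x : ℝ) (1 / (N * x.den))) := by
    have h1 := (measure_mono (μ := volume) hcover).trans (measure_union_le _ _)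
    rw [Real.volume_closedBall, show 2 * (ρ / 2) = ρ / 2 + ρ / 2 by ring,
      ENNReal.ofReal_add (by positivity) (by positivity)] at h1
    have h2 := h1.trans (add_le_add_left hbad _)
    exact (ENNReal.add_le_add_iff_left ENNReal.ofReal_ne_top).1 h2
  -- Distinct fractions with denominators below `N` are more than `1 / N²` apart, and `2 / K ≤ 1`.
  have hdisj : X.PairwiseDisjoint fun x : ℚ => Metric.closedBall (x : ℝ) (1 / (K * N ^ 2)) := by
    intro x hx z hz hxz
    refine Metric.closedBall_disjoint_closedBall ?_
    rw [Real.dist_eq]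
    refine lt_of_lt_of_le ?_ (Rat.one_div_den_mul_den_le_abs_sub hxz)
    have hx' := hXden x hx
    have hz' := hXden z hz
    have hx0 : (0 : ℝ) < x.den := by linarith
    have hz0 : (0 : ℝ) < z.den := by linarith
    calc 1 / (K * N ^ 2) + 1 / (K * N ^ 2) = 2 / K * (1 / N ^ 2) := by field_simp; ring
      _ ≤ 1 * (1 / N ^ 2) := by
          refine mul_le_mul_of_nonneg_right ?_ (by positivity)
          rwa [div_le_one hK0]
      _ < 1 / ((x.den : ℝ) * z.den) := by
          rw [one_mul]
          refine one_div_lt_one_div_of_lt (by positivity) ?_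
          nlinarith
  have hsub : ⋃ x ∈ X, Metric.closedBall (x : ℝ) (1 / (K * N ^ 2))
      ⊆ goodScale K m ∩ Metric.closedBall y ρ := by
    intro β hβ
    simp only [Set.mem_iUnion, exists_prop, Metric.mem_closedBall, Real.dist_eq] at hβ
    obtain ⟨x, hx, hβ⟩ := hβ
    have hx' := hXden x hx
    have hx0 : (0 : ℝ) < x.den := by linarith
    have h1 : 1 / (K * N ^ 2) ≤ 1 / (K * (x.den : ℝ) ^ 2) := by
      refine one_div_le_one_div_of_le (by positivity) ?_
      have := hx'.2.le
      gcongr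
    refine ⟨⟨x, hx.1, hx.2.1, hβ.trans h1⟩, ?_⟩
    obtain ⟨α, hα, hαx⟩ := hx.2.2
    rw [Metric.mem_closedBall, Real.dist_eq] at hα ⊢
    have h2 : 1 / (N * x.den) ≤ 1 / 2 * (1 / 2) ^ m := by
      rw [one_div_pow, ← one_div_mul_one_div_rev, mul_comm]
      refine mul_le_mul (one_div_le_one_div_of_le (by norm_num) (by linarith))
        (one_div_le_one_div_of_le (by positivity) hx'.1) (by positivity) (by norm_num)
    have h3 : 1 / (K * N ^ 2) ≤ 1 / 2 * (1 / 2) ^ m := by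
      rw [one_div_pow, ← one_div_mul_one_div_rev, mul_comm]
      refine mul_le_mul (one_div_le_one_div_of_le (by norm_num) hK)
        (one_div_le_one_div_of_le (by positivity) ?_) (by positivity) (by norm_num)
      nlinarith
    have h4 : |β - y| ≤ |β - x| + |α - x| + |α - y| := by
      have := abs_add_three (β - x) (-(α - x)) (α - y)
      rw [abs_neg] at this
      rwa [show β - x + -(α - x) + (α - y) = β - y by ring] at this
    linarith
  refine le_trans ?_ (measure_mono hsub)
  rw [measure_biUnion (Set.to_countable _) hdisj
    fun x _ => Metric.isClosed_closedBall.measurableSet]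
  have hbig : ENNReal.ofReal (ρ / 2) ≤ ∑' x : X, ENNReal.ofReal (16 * K) *
      volume (Metric.closedBall ((x : ℚ) : ℝ) (1 / (K * N ^ 2))) := by
    refine hhalf.trans ((measure_biUnion_le volume (Set.to_countable X) _).trans
      (ENNReal.tsum_le_tsum fun x => ?_))
    have hx' := hXden x x.2
    have hx0 : (0 : ℝ) < (x : ℚ).den := by linarith
    rw [Real.volume_closedBall, Real.volume_closedBall, ← ENNReal.ofReal_mul (by positivity)]
    refine ENNReal.ofReal_le_ofReal ?_
    rw [show 16 * K * (2 * (1 / (K * N ^ 2))) = 2 * (16 / (N * N)) by field_simp]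
    refine mul_le_mul_of_nonneg_left ?_ (by norm_num)
    rw [div_le_div_iff₀ (by positivity) (by positivity)]
    nlinarith [hx'.1]
  rw [ENNReal.tsum_mul_left] at hbig
  rw [show ρ / (32 * K) = (ρ / 2) / (16 * K) by field_simp; norm_num,
    ENNReal.ofReal_div_of_pos (by positivity)]
  exact ENNReal.div_le_of_le_mul' hbig

/-- If the sum were at most `C` on a set of positive measure, it would have finite integral over
that set near a density point. But every late scale occupies there at least a fixed measure, so the
integral dominates a tail of the harmonic series. No independence between scales is needed. -/
theorem ae_tsum_goodScale_eq_top {K : ℝ} (hK : 2 ≤ K) :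
    ∀ᵐ α : ℝ, ∑' m : ℕ, (goodScale K m).indicator (fun _ => ((m : ENNReal) + 1)⁻¹) α = ⊤ := by
  set X : ℝ → ENNReal := fun α =>
    ∑' m : ℕ, (goodScale K m).indicator (fun _ => ((m : ENNReal) + 1)⁻¹) α with hX
  have hterm : ∀ m : ℕ, Measurable ((goodScale K m).indicator
      (fun _ : ℝ => ((m : ENNReal) + 1)⁻¹)) :=
    fun m => measurable_const.indicator (measurableSet_goodScale K m)
  have hXm : Measurable X := Measurable.tsum hterm
  have hnull : ∀ C : ℕ, volume {α | X α ≤ C} = 0 := by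
    intro C
    by_contra hpos
    have hDm : MeasurableSet {α | X α ≤ C} := measurableSet_le hXm measurable_const
    have hK0 : 0 < K := by linarith
    obtain ⟨y, ρ, hρ, -, hball⟩ := exists_closedBall_diff_le volume hDm hpos
      (δ := ENNReal.ofReal (1 / (128 * K)))
      (ENNReal.ofReal_pos.2 (by positivity)).ne' one_pos
    set D := {α | X α ≤ C} with hD
    obtain ⟨m₀, hm₀⟩ := exists_le_volume_goodScale_inter hK y hρ
    have hlow : ∀ m ≥ m₀, ENNReal.ofReal (ρ / (64 * K))
        ≤ volume (goodScale K m ∩ (D ∩ Metric.closedBall y ρ)) := by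
      intro m hm
      have h1 := hm₀ m hm
      have h2 : goodScale K m ∩ Metric.closedBall y ρ
          ⊆ (goodScale K m ∩ (D ∩ Metric.closedBall y ρ)) ∪ (Metric.closedBall y ρ \ D) := by
        rintro α ⟨h3, h4⟩
        by_cases h5 : α ∈ D
        · exact Or.inl ⟨h3, h5, h4⟩
        · exact Or.inr ⟨h4, h5⟩
      have h3 := h1.trans ((measure_mono h2).trans (measure_union_le _ _))
      rw [Real.volume_closedBall, ← ENNReal.ofReal_mul (by positivity),
        show 1 / (128 * K) * (2 * ρ) = ρ / (64 * K) by field_simp; norm_num] at hball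
      rw [show ρ / (32 * K) = ρ / (64 * K) + ρ / (64 * K) by field_simp; norm_num,
        ENNReal.ofReal_add (by positivity) (by positivity)] at h3
      exact (ENNReal.add_le_add_iff_right ENNReal.ofReal_ne_top).1
        (h3.trans (add_le_add_right hball _))
    have hint : ∫⁻ α in D ∩ Metric.closedBall y ρ, X α
        = ∑' m : ℕ, ((m : ENNReal) + 1)⁻¹ * volume (goodScale K m ∩ (D ∩ Metric.closedBall y ρ)) := by
      rw [hX, lintegral_tsum fun m => (hterm m).aemeasurable]
      refine tsum_congr fun m => ?_
      rw [lintegral_indicator_const (measurableSet_goodScale K m),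
        Measure.restrict_apply (measurableSet_goodScale K m)]
    have hup : ∫⁻ α in D ∩ Metric.closedBall y ρ, X α < ⊤ := by
      refine lt_of_le_of_lt (setLIntegral_mono measurable_const (g := fun _ => (C : ENNReal))
        fun α hα => hα.1) ?_
      rw [setLIntegral_const]
      exact ENNReal.mul_lt_top (ENNReal.natCast_lt_top C)
        ((measure_mono Set.inter_subset_right).trans_lt
          (isCompact_closedBall y ρ).measure_lt_top)
    have hdiv : ∑' m : ℕ, (((m + m₀ : ℕ) : ENNReal) + 1)⁻¹ * ENNReal.ofReal (ρ / (64 * K)) = ⊤ := by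
      rw [ENNReal.tsum_mul_right]
      have hharm : ∑' m : ℕ, (((m + m₀ : ℕ) : ENNReal) + 1)⁻¹ = ⊤ := by
        by_contra hne
        have h1 := ENNReal.summable_toReal hne
        have h2 : ¬ Summable fun m : ℕ => 1 / ((m : ℝ) + ((m₀ : ℝ) + 1)) := by
          have := (summable_nat_add_iff (f := fun n : ℕ => 1 / (n : ℝ)) (m₀ + 1)).not.2
            Real.not_summable_one_div_natCast
          simpa using this
        refine h2 (h1.congr fun m => ?_)
        rw [ENNReal.toReal_inv, ENNReal.toReal_add (ENNReal.natCast_ne_top _) ENNReal.one_ne_top,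
          ENNReal.toReal_natCast, ENNReal.toReal_one, one_div]
        push_cast
        ring
      rw [hharm]
      exact ENNReal.top_mul (ENNReal.ofReal_pos.2 (by positivity)).ne'
    have hge : ∑' m : ℕ, (((m + m₀ : ℕ) : ENNReal) + 1)⁻¹ * ENNReal.ofReal (ρ / (64 * K))
        ≤ ∫⁻ α in D ∩ Metric.closedBall y ρ, X α := by
      rw [hint]
      refine le_trans (ENNReal.tsum_le_tsum fun m =>
        mul_le_mul_right (hlow (m + m₀) (Nat.le_add_left _ _)) _) ?_
      exact ENNReal.tsum_comp_le_tsum_of_injective (add_left_injective m₀)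
        fun m : ℕ => ((m : ENNReal) + 1)⁻¹ * volume (goodScale K m ∩ (D ∩ Metric.closedBall y ρ))
    rw [hdiv] at hge
    exact absurd hge (not_le.2 hup)
  have hall : ∀ᵐ α : ℝ, ∀ C : ℕ, ¬ X α ≤ C :=
    ae_all_iff.2 fun C => by
      rw [ae_iff]
      simpa using hnull C
  filter_upwards [hall] with α hα
  by_contra hne
  obtain ⟨n, hn⟩ := ENNReal.exists_nat_gt hne
  exact hα n hn.le

/-- Almost every real has good rational approximations at many scales: the scales `m` at which
`goodScale` holds have divergent harmonic sum. -/
theorem ae_exists_finset_goodScale :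
    ∀ᵐ α : ℝ, ∀ (K : ℝ) (m₀ : ℕ) (M : ℝ), 0 < K → ∃ s : Finset ℕ,
      (∀ m ∈ s, m₀ ≤ m ∧ α ∈ goodScale K m) ∧ M ≤ ∑ m ∈ s, 1 / ((m : ℝ) + 1) := by
  have hall : ∀ᵐ α : ℝ, ∀ k : ℕ, ∑' m : ℕ, (goodScale (k + 2) m).indicator
      (fun _ => ((m : ENNReal) + 1)⁻¹) α = ⊤ :=
    ae_all_iff.2 fun k => ae_tsum_goodScale_eq_top (by linarith [Nat.cast_nonneg (α := ℝ) k])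
  filter_upwards [hall] with α hα K m₀ M hK
  classical
  obtain ⟨k, hk⟩ := exists_nat_ge K
  -- `goodScale` shrinks as `K` grows, so countably many integer values handle all `K` off a single
  -- null set.
  have hsub : ∀ m, α ∈ goodScale (k + 2) m → α ∈ goodScale K m := by
    rintro m ⟨x, hx1, hx2, hx3⟩
    have hx0 : (0 : ℝ) < x.den := Nat.cast_pos.2 x.den_pos
    refine ⟨x, hx1, hx2, hx3.trans (one_div_le_one_div_of_le (by positivity) ?_)⟩
    gcongr
    linarith
  by_contra! hcon
  set g : ℕ → ℝ := fun m => if α ∈ goodScale (k + 2) m then 1 / ((m : ℝ) + 1) else 0 with hg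
  have hg0 : ∀ m, 0 ≤ g m := fun m => by
    simp only [hg]
    split_ifs <;> positivity
  have hsum : Summable fun m => g (m + m₀) := by
    refine summable_of_sum_le (c := M) (fun m => hg0 _) fun u => ?_
    have h1 := hcon ((u.map (addRightEmbedding m₀)).filter fun m => α ∈ goodScale (k + 2) m)
      (fun m hm => by
        obtain ⟨h2, h3⟩ := Finset.mem_filter.1 hm
        obtain ⟨a, -, rfl⟩ := Finset.mem_map.1 h2
        exact ⟨Nat.le_add_left _ _, hsub _ h3⟩)
    rw [Finset.sum_filter, Finset.sum_map] at h1
    exact h1.le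
  have hsum' : Summable g := (summable_nat_add_iff m₀).1 hsum
  have htop := hα k
  have hterm : ∀ m : ℕ, (goodScale (k + 2) m).indicator (fun _ => ((m : ENNReal) + 1)⁻¹) α
      = ENNReal.ofReal (g m) := by
    intro m
    simp only [hg, Set.indicator_apply]
    split_ifs
    · rw [one_div, ENNReal.ofReal_inv_of_pos (by positivity),
        ENNReal.ofReal_add (Nat.cast_nonneg m) zero_le_one, ENNReal.ofReal_natCast,
        ENNReal.ofReal_one]
    · simp
  rw [tsum_congr hterm, ← ENNReal.ofReal_tsum_of_nonneg hg0 hsum'] at htop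
  exact ENNReal.ofReal_ne_top htop

/-! ### Second moments of multi-scale families of intervals -/

/-- Integrate `(∑ 1_{A i} - c)² ≥ 0`. This is Cauchy–Schwarz with a free parameter `c`. -/
theorem two_mul_sum_measureReal_le {Ω ι : Type*} [MeasurableSpace Ω] (ν : Measure Ω)
    [IsFiniteMeasure ν] (s : Finset ι) {A : ι → Set Ω} (hA : ∀ i ∈ s, MeasurableSet (A i)) (c : ℝ) :
    2 * c * ∑ i ∈ s, ν.real (A i)
      ≤ ∑ i ∈ s, ∑ j ∈ s, ν.real (A i ∩ A j) + c ^ 2 * ν.real Set.univ := by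
  set g : ι → Ω → ℝ := fun i => (A i).indicator 1 with hg
  have hgi : ∀ i ∈ s, Integrable (g i) ν := fun i hi =>
    (integrable_const (1 : ℝ)).indicator (hA i hi)
  have hgint : ∀ i ∈ s, ∫ ω, g i ω ∂ν = ν.real (A i) := fun i hi => integral_indicator_one (hA i hi)
  have hgg : ∀ i j, (fun ω => g i ω * g j ω) = (A i ∩ A j).indicator 1 :=
    fun i j => by rw [Set.inter_indicator_one]; rfl
  have hggi : ∀ i ∈ s, ∀ j ∈ s, Integrable (fun ω => g i ω * g j ω) ν := fun i hi j hj => by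
    rw [hgg]
    exact (integrable_const (1 : ℝ)).indicator ((hA i hi).inter (hA j hj))
  have hggint : ∀ i ∈ s, ∀ j ∈ s, ∫ ω, g i ω * g j ω ∂ν = ν.real (A i ∩ A j) :=
    fun i hi j hj => by
      rw [hgg]
      exact integral_indicator_one ((hA i hi).inter (hA j hj))
  have h0 : 0 ≤ ∫ ω, (∑ i ∈ s, ∑ j ∈ s, g i ω * g j ω - 2 * c * ∑ i ∈ s, g i ω + c ^ 2) ∂ν := by
    refine integral_nonneg fun ω => ?_
    have : (∑ i ∈ s, ∑ j ∈ s, g i ω * g j ω - 2 * c * ∑ i ∈ s, g i ω + c ^ 2)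
        = (∑ i ∈ s, g i ω - c) ^ 2 := by
      rw [← Finset.sum_mul_sum]
      ring
    rw [Pi.zero_apply, this]
    positivity
  have i1 : Integrable (fun ω => ∑ i ∈ s, ∑ j ∈ s, g i ω * g j ω) ν :=
    integrable_finsetSum _ fun i hi => integrable_finsetSum _ fun j hj => hggi i hi j hj
  have i2 : Integrable (fun ω => 2 * c * ∑ i ∈ s, g i ω) ν :=
    (integrable_finsetSum _ hgi).const_mul _
  have i3 : Integrable (fun ω => ∑ i ∈ s, ∑ j ∈ s, g i ω * g j ω - 2 * c * ∑ i ∈ s, g i ω) ν :=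
    i1.sub i2
  rw [integral_add i3 (integrable_const _), integral_sub i1 i2, integral_const_mul,
    integral_finsetSum _ fun i hi => integrable_finsetSum _ fun j hj => hggi i hi j hj,
    integral_finsetSum _ hgi, Finset.sum_congr rfl hgint, integral_const,
    Finset.sum_congr rfl fun i hi => (integral_finsetSum _ fun j hj => hggi i hi j hj).trans
      (Finset.sum_congr rfl (hggint i hi))] at h0
  rw [smul_eq_mul] at h0
  linarith

/-- The `P` term is the quasi-independent part. The `R` term decays geometrically with the gap
between scales, so for fixed `l` it sums over `m` to a multiple of `a l` and is only linear in the
total. Symmetry in `m` and `l` costs the factor `2`. -/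
theorem sum_sum_le_of_geometric {s : Finset ℕ} {a : ℕ → ℝ} {c : ℕ → ℕ → ℝ} {P R : ℝ}
    (hP : 0 ≤ P) (hR : 0 ≤ R) (ha : ∀ m ∈ s, 0 ≤ a m) (hsymm : ∀ m l, c m l = c l m)
    (hc : ∀ m ∈ s, ∀ l ∈ s, m ≤ l → c m l ≤ P * (a m * a l) + R * (2 ^ m / 2 ^ l * a l)) :
    ∑ m ∈ s, ∑ l ∈ s, c m l ≤ 2 * (P * (∑ m ∈ s, a m) ^ 2 + 2 * R * ∑ m ∈ s, a m) := by
  set d : ℕ → ℕ → ℝ := fun m l =>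
    P * (a m * a l) + R * ((if m ≤ l then 2 ^ m / 2 ^ l else 0) * a l) with hd
  have hd0 : ∀ m ∈ s, ∀ l ∈ s, 0 ≤ d m l := by
    intro m hm l hl
    have := ha m hm
    have := ha l hl
    simp only [hd]
    split_ifs <;> positivity
  have hcd : ∀ m ∈ s, ∀ l ∈ s, c m l ≤ d m l + d l m := by
    intro m hm l hl
    rcases le_total m l with h | h
    · have h1 := hc m hm l hl h
      have h2 : d m l = P * (a m * a l) + R * (2 ^ m / 2 ^ l * a l) := by simp [hd, h]
      linarith [hd0 l hl m hm]
    · have h1 := hc l hl m hm h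
      rw [hsymm] at h1
      have h2 : d l m = P * (a l * a m) + R * (2 ^ l / 2 ^ m * a m) := by simp [hd, h]
      linarith [hd0 m hm l hl]
  have hgeo : ∀ l, ∑ m ∈ s, (if m ≤ l then (2 : ℝ) ^ m / 2 ^ l else 0) ≤ 2 := by
    intro l
    rw [← Finset.sum_filter]
    have h1 : ∑ m ∈ s.filter (· ≤ l), (2 : ℝ) ^ m / 2 ^ l
        ≤ ∑ m ∈ Finset.range (l + 1), (2 : ℝ) ^ m / 2 ^ l :=
      Finset.sum_le_sum_of_subset_of_nonneg
        (fun m hm => Finset.mem_range.2 (Nat.lt_succ_of_le (Finset.mem_filter.1 hm).2))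
        fun m _ _ => by positivity
    refine h1.trans ?_
    rw [← Finset.sum_div, div_le_iff₀ (by positivity), geom_sum_eq (by norm_num)]
    rw [pow_succ]
    linarith [pow_pos (show (0 : ℝ) < 2 by norm_num) l]
  have hsumd : ∑ m ∈ s, ∑ l ∈ s, d m l ≤ P * (∑ m ∈ s, a m) ^ 2 + 2 * R * ∑ m ∈ s, a m := by
    have h1 : ∑ m ∈ s, ∑ l ∈ s, d m l = P * (∑ m ∈ s, a m) ^ 2
        + R * ∑ l ∈ s, (∑ m ∈ s, (if m ≤ l then (2 : ℝ) ^ m / 2 ^ l else 0)) * a l := by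
      simp only [hd, Finset.sum_add_distrib, ← Finset.mul_sum]
      congr 1
      · rw [pow_two, Finset.sum_mul]
      · rw [Finset.sum_comm]
        simp only [Finset.sum_mul]
    rw [h1]
    refine add_le_add_right ?_ _
    rw [mul_comm 2 R, mul_assoc]
    refine mul_le_mul_of_nonneg_left ?_ hR
    rw [Finset.mul_sum]
    exact Finset.sum_le_sum fun l hl => mul_le_mul_of_nonneg_right (hgeo l) (ha l hl)
  calc ∑ m ∈ s, ∑ l ∈ s, c m l ≤ ∑ m ∈ s, ∑ l ∈ s, (d m l + d l m) :=
        Finset.sum_le_sum fun m hm => Finset.sum_le_sum fun l hl => hcd m hm l hl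
    _ = ∑ m ∈ s, ∑ l ∈ s, d m l + ∑ m ∈ s, ∑ l ∈ s, d m l := by
        simp only [Finset.sum_add_distrib]
        congr 1
        exact Finset.sum_comm
    _ ≤ _ := by linarith

/-- Since `q * z i` lies in `[i, i + 1]`, the indices of the intervals meeting the given ball lie in
a segment of length `2 q (d + e) + 1`. -/
theorem sum_overlap_cell_le {I : Finset ℤ} {q : ℕ} {z : ℤ → ℝ} {e : ℝ} (t c : ℝ) {d : ℝ}
    (hz : ∀ i ∈ I, i ≤ q * z i ∧ q * z i ≤ i + 1) (he : 0 ≤ e) (hd : 0 ≤ d) :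
    ∑ i ∈ I, volume.real (Metric.closedBall c d ∩ Metric.closedBall (z i + t) e)
      ≤ (2 * (q * d) + 2 * (q * e) + 2) * (2 * e) := by
  have hq : (0 : ℝ) ≤ q := Nat.cast_nonneg q
  classical
  have h1 : ∑ i ∈ I, volume.real (Metric.closedBall c d ∩ Metric.closedBall (z i + t) e)
      ≤ ∑ i ∈ I, if (Metric.closedBall c d ∩ Metric.closedBall (z i + t) e).Nonempty
        then 2 * e else 0 := by
    refine Finset.sum_le_sum fun i _ => ?_
    split_ifs with h
    · refine (measureReal_mono Set.inter_subset_right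
        (isCompact_closedBall _ _).measure_lt_top.ne).trans (le_of_eq ?_)
      rw [Measure.real, Real.volume_closedBall, ENNReal.toReal_ofReal (by positivity)]
    · rw [Set.not_nonempty_iff_eq_empty.1 h]
      simp
  refine h1.trans ?_
  rw [← Finset.sum_filter, Finset.sum_const, nsmul_eq_mul]
  refine mul_le_mul_of_nonneg_right ?_ (by positivity)
  refine (card_int_le (a := q * (c - t - d - e) - 1) (b := q * (c - t + d + e))
    (by nlinarith) fun i hi => ?_).trans (by linarith)
  obtain ⟨hiI, w, hw1, hw2⟩ := Finset.mem_filter.1 hi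
  rw [Metric.mem_closedBall, Real.dist_eq, abs_le] at hw1 hw2
  have h2 := hz i hiI
  have h3 : q * (c - t - d - e) ≤ q * z i := mul_le_mul_of_nonneg_left (by linarith) hq
  have h4 : q * z i ≤ q * (c - t + d + e) := mul_le_mul_of_nonneg_left (by linarith) hq
  constructor <;> linarith

/-- Second moment bound for the counting function of a multi-scale family of short intervals,
one in each cell of length `1 / q m` meeting a given interval of length `ρ`. -/
theorem sum_overlap_le {s : Finset ℕ} {I : ℕ → Finset ℤ} {q : ℕ → ℕ} {z : ℕ → ℤ → ℝ}
    {e : ℕ → ℝ} (t : ℕ → ℝ) {ρ : ℝ} (hρ : 0 < ρ)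
    (hq : ∀ m ∈ s, 2 ^ m ≤ q m ∧ q m < 2 ^ (m + 4))
    (hz : ∀ m ∈ s, ∀ i ∈ I m, i ≤ q m * z m i ∧ q m * z m i ≤ i + 1)
    (he : ∀ m ∈ s, 0 ≤ e m ∧ q m * e m ≤ 1 / 8)
    (hI : ∀ m ∈ s, ρ * q m / 2 ≤ (I m).card ∧ ((I m).card : ℝ) ≤ 2 * ρ * q m) :
    ∑ a ∈ s.sigma I, ∑ b ∈ s.sigma I, volume.real
        (Metric.closedBall (z a.1 a.2 + t a.1) (e a.1) ∩
          Metric.closedBall (z b.1 b.2 + t b.1) (e b.1))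
      ≤ 2 * (2 / ρ * (∑ m ∈ s, (I m).card * (2 * e m)) ^ 2
        + 2 * 192 * ∑ m ∈ s, (I m).card * (2 * e m)) := by
  set c : ℕ → ℕ → ℝ := fun m l => ∑ i ∈ I m, ∑ j ∈ I l, volume.real
        (Metric.closedBall (z m i + t m) (e m) ∩ Metric.closedBall (z l j + t l) (e l)) with hc
  have hsum : ∑ a ∈ s.sigma I, ∑ b ∈ s.sigma I, volume.real
        (Metric.closedBall (z a.1 a.2 + t a.1) (e a.1) ∩
          Metric.closedBall (z b.1 b.2 + t b.1) (e b.1)) = ∑ m ∈ s, ∑ l ∈ s, c m l := by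
    rw [Finset.sum_sigma]
    refine Finset.sum_congr rfl fun m _ => ?_
    simp only [Finset.sum_sigma, hc]
    exact Finset.sum_comm
  rw [hsum]
  refine sum_sum_le_of_geometric (by positivity) (by norm_num) (fun m hm => ?_) (fun m l => ?_)
    fun m hm l hl _ => ?_
  · have := (he m hm).1
    positivity
  · simp only [hc]
    rw [Finset.sum_comm]
    exact Finset.sum_congr rfl fun j _ => Finset.sum_congr rfl fun i _ => by rw [Set.inter_comm]
  · have hem := he m hm
    have hel := he l hl
    have hql : (2 : ℝ) ^ l ≤ q l := by exact_mod_cast (hq l hl).1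
    have hqm : (q m : ℝ) ≤ 16 * 2 ^ m := by
      have h1 : (q m : ℝ) ≤ 2 ^ (m + 4) := by exact_mod_cast (hq m hm).2.le
      rw [pow_add] at h1
      linarith
    have hql0 : (0 : ℝ) < 2 ^ l := by positivity
    have h1 : c m l ≤ (I m).card * ((2 * (q l * e m) + 2 * (q l * e l) + 2) * (2 * e l)) := by
      rw [← nsmul_eq_mul]
      exact Finset.sum_le_card_nsmul _ _ _ fun i _ =>
        sum_overlap_cell_le (t l) (z m i + t m) (hz l hl) hel.1 hem.1
    have hIl := (hI l hl).1
    have hIm := (hI m hm).2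
    have hnm : (0 : ℝ) ≤ (I m).card := Nat.cast_nonneg _
    have h2 : (q l : ℝ) ≤ 2 / ρ * (I l).card := by
      rw [div_mul_eq_mul_div, le_div_iff₀ hρ]
      linarith
    have h3 : ((I m).card : ℝ) ≤ 64 * (2 ^ m / 2 ^ l) * (I l).card := by
      have h4 : (2 : ℝ) ^ l ≤ 2 / ρ * (I l).card := hql.trans h2
      have h5 : (1 : ℝ) ≤ 2 / ρ * (I l).card / 2 ^ l := by rwa [one_le_div hql0]
      calc ((I m).card : ℝ) ≤ 2 * ρ * (16 * 2 ^ m) := hIm.trans (by gcongr)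
        _ = 2 * ρ * (16 * 2 ^ m) * 1 := by ring
        _ ≤ 2 * ρ * (16 * 2 ^ m) * (2 / ρ * (I l).card / 2 ^ l) := by gcongr
        _ = _ := by field_simp; ring
    refine h1.trans ?_
    have hel2 : 0 ≤ 2 * e l := by linarith [hel.1]
    have hem2 : 0 ≤ 2 * e m := by linarith [hem.1]
    -- The finer intervals counted by the length of the coarser one: this is the product of the two
    -- total lengths, up to `2 / ρ`.
    have h6 : ((I m).card : ℝ) * ((2 * (q l * e m)) * (2 * e l))
        ≤ 2 / ρ * ((I m).card * (2 * e m) * ((I l).card * (2 * e l))) := by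
      have := mul_le_mul_of_nonneg_left h2 (mul_nonneg (mul_nonneg hnm hem2) hel2)
      linarith
    -- The boundary count is at most `3` for each coarser interval, and there are few of these: `|I
    -- m| ≤ 64 · 2^(m-l) |I l|`.
    have h7 : ((I m).card : ℝ) * ((2 * (q l * e l) + 2) * (2 * e l))
        ≤ 192 * (2 ^ m / 2 ^ l * ((I l).card * (2 * e l))) := by
      have h8 : (2 * (q l * e l) + 2) * (2 * e l) ≤ 3 * (2 * e l) :=
        mul_le_mul_of_nonneg_right (by linarith [hel.2]) hel2
      have h9 := mul_le_mul_of_nonneg_left h8 hnm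
      have h10 := mul_le_mul_of_nonneg_right h3 (mul_nonneg (by norm_num : (0 : ℝ) ≤ 3) hel2)
      linarith
    linarith

/-- If the counting function of a family of intervals has controlled second moment, then a set of
small relative measure in a square meets few of the corresponding vertical strips. -/
theorem sum_strip_le {ι : Type*} {s : Finset ι} {c d : ι → ℝ} {W : Set (ℝ × ℝ)} {y ρ M : ℝ}
    (hρ : 0 < ρ) (hM : 0 < M) (hWfin : volume W ≠ ⊤)
    (hWsub : ∀ w ∈ W, w.2 ∈ Metric.closedBall y ρ) (hW : volume.real W ≤ 4 * ρ ^ 2 / 100000)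
    (hV : ∑ a ∈ s, ∑ b ∈ s, volume.real (Metric.closedBall (c a) (d a) ∩
      Metric.closedBall (c b) (d b)) ≤ 772 * M ^ 2 / ρ) :
    ∑ a ∈ s, (volume.restrict W).real (Metric.closedBall (c a) (d a) ×ˢ Set.univ)
      ≤ ρ * M / 4 := by
  have : IsFiniteMeasure (volume.restrict W) :=
    ⟨by rw [Measure.restrict_apply_univ]; exact hWfin.lt_top⟩
  have hmeas : ∀ a ∈ s, MeasurableSet (Metric.closedBall (c a) (d a) ×ˢ (Set.univ : Set ℝ)) :=
    fun a _ => Metric.isClosed_closedBall.measurableSet.prod MeasurableSet.univ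
  -- The parameter is `6176 = 8 · 772` times `M / ρ`: the second moment term contributes `1544 M²`,
  -- exactly half of the permitted `3088 M²`, and the bound on `W` keeps the other term below `1544
  -- M²`.
  have h1 := two_mul_sum_measureReal_le (volume.restrict W) s hmeas (6176 * M / ρ)
  have h2 : ∀ a ∈ s, ∀ b ∈ s, (volume.restrict W).real
      (Metric.closedBall (c a) (d a) ×ˢ Set.univ ∩ Metric.closedBall (c b) (d b) ×ˢ Set.univ)
      ≤ 2 * ρ * volume.real (Metric.closedBall (c a) (d a) ∩ Metric.closedBall (c b) (d b)) := by
    intro a ha b hb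
    rw [measureReal_restrict_apply ((hmeas a ha).inter (hmeas b hb))]
    have hfin : volume (Metric.closedBall (c a) (d a) ∩ Metric.closedBall (c b) (d b)) ≠ ⊤ :=
      ((measure_mono Set.inter_subset_left).trans_lt
        (isCompact_closedBall _ _).measure_lt_top).ne
    have hle : volume (Metric.closedBall (c a) (d a) ×ˢ Set.univ ∩
        Metric.closedBall (c b) (d b) ×ˢ Set.univ ∩ W)
        ≤ volume (Metric.closedBall (c a) (d a) ∩ Metric.closedBall (c b) (d b))
          * ENNReal.ofReal (2 * ρ) := by
      rw [← Real.volume_closedBall y ρ, Measure.volume_eq_prod, ← Measure.prod_prod]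
      refine measure_mono ?_
      rintro w ⟨⟨hwa, hwb⟩, hwW⟩
      exact ⟨⟨hwa.1, hwb.1⟩, hWsub w hwW⟩
    have h3 := ENNReal.toReal_mono (ENNReal.mul_ne_top hfin ENNReal.ofReal_ne_top) hle
    rw [ENNReal.toReal_mul, ENNReal.toReal_ofReal (by positivity)] at h3
    rw [mul_comm]
    exact h3
  have h3 := Finset.sum_le_sum fun a ha => Finset.sum_le_sum fun b hb => h2 a ha b hb
  simp only [← Finset.mul_sum] at h3
  have h4 : 2 * ρ * ∑ a ∈ s, ∑ b ∈ s, volume.real (Metric.closedBall (c a) (d a) ∩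
      Metric.closedBall (c b) (d b)) ≤ 2 * ρ * (772 * M ^ 2 / ρ) :=
    mul_le_mul_of_nonneg_left hV (by positivity)
  have h5 : (volume.restrict W).real Set.univ ≤ 4 * ρ ^ 2 / 100000 := by
    rwa [measureReal_restrict_apply_univ]
  have h6 : (6176 * M / ρ) ^ 2 * (volume.restrict W).real Set.univ
      ≤ (6176 * M / ρ) ^ 2 * (4 * ρ ^ 2 / 100000) := mul_le_mul_of_nonneg_left h5 (by positivity)
  set S := ∑ a ∈ s, (volume.restrict W).real (Metric.closedBall (c a) (d a) ×ˢ Set.univ)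
  have h7 : 2 * (6176 * M / ρ) * S ≤ 2 * ρ * (772 * M ^ 2 / ρ)
      + (6176 * M / ρ) ^ 2 * (4 * ρ ^ 2 / 100000) := by linarith
  have h8 : 2 * ρ * (772 * M ^ 2 / ρ) + (6176 * M / ρ) ^ 2 * (4 * ρ ^ 2 / 100000)
      = (1544 + 6176 ^ 2 * 4 / 100000) * M ^ 2 := by field_simp; norm_num
  have h9 : 2 * (6176 * M / ρ) * S ≤ 2 * (6176 * M / ρ) * (ρ * M / 4) := by
    rw [show 2 * (6176 * M / ρ) * (ρ * M / 4) = 3088 * M ^ 2 by field_simp; norm_num]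
    refine h7.trans (h8.trans_le ?_)
    have := sq_nonneg M
    nlinarith
  exact le_of_mul_le_mul_left h9 (by positivity)

/-! ### The density argument -/

/-- A shear preserving `F` moves the part of a small rectangle on which `F` is not invariant under
the vertical translation by `r` off the set of such points. -/
theorem rectangle_le_strips {F : Set (ℝ × ℝ)} {g : ℝ → ℝ} (hF : MeasurableSet F)
    (hg : Measurable g) {x y ρ r τ c d : ℝ} (hρ : 0 < ρ) (hd : 0 ≤ d)
    (hinv : ∀ z ∈ F, (z.1 + τ, z.2 + g z.1) ∈ F)
    (hlevel : ∀ a ∈ Metric.closedBall c d, |g a - r| ≤ ρ / 2)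
    (hsub : ∀ a ∈ Metric.closedBall c d, a ∈ Metric.closedBall x ρ ∧ a + τ ∈ Metric.closedBall x ρ)
    {W : Set (ℝ × ℝ)}
    (hW : W = Metric.closedBall (x, y) ρ \ {z | z ∈ F ∧ (z.1, z.2 + r) ∉ F}) :
    2 * d * ρ ≤ (volume.restrict W).real (Metric.closedBall c d ×ˢ Set.univ)
      + (volume.restrict W).real (Metric.closedBall (c + τ) d ×ˢ Set.univ) := by
  set D := {z : ℝ × ℝ | z ∈ F ∧ (z.1, z.2 + r) ∉ F} with hD
  have hDm : MeasurableSet D :=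
    hF.inter ((measurable_fst.prodMk (measurable_snd.add_const r)) hF).compl
  have hBfin : volume (Metric.closedBall (x, y) ρ) ≠ ⊤ :=
    (isCompact_closedBall _ _).measure_lt_top.ne
  have hWm : MeasurableSet W := hW ▸ Metric.isClosed_closedBall.measurableSet.diff hDm
  have hWfin : volume W ≠ ⊤ :=
    ((measure_mono (hW ▸ Set.sdiff_subset)).trans_lt hBfin.lt_top).ne
  have hm : ∀ c' : ℝ, MeasurableSet (Metric.closedBall c' d ×ˢ (Set.univ : Set ℝ)) :=
    fun c' => Metric.isClosed_closedBall.measurableSet.prod MeasurableSet.univ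
  have hstrip : ∀ c' : ℝ, volume (Metric.closedBall c' d ×ˢ (Set.univ : Set ℝ) ∩ W) ≠ ⊤ :=
    fun c' => ((measure_mono Set.inter_subset_right).trans_lt hWfin.lt_top).ne
  have hΦ : MeasurePreserving (fun z : ℝ × ℝ => (z.1 + τ, z.2 + (g z.1 - r))) volume volume := by
    rw [Measure.volume_eq_prod]
    exact (measurePreserving_add_right volume τ).skew_product
       (by fun_prop)
      (ae_of_all _ fun a => (measurePreserving_add_right volume (g a - r)).map_eq)
  set R := Metric.closedBall c d ×ˢ Metric.closedBall y (ρ / 2) with hR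
  -- A point of the rectangle outside `D` is already in `W`. For a point of `D`, the shear lowered
  -- by `r` gives a point which translation by `r` carries into `F`; hence it is not in `D`. It
  -- remains in the square because the height changes by at most `ρ / 2`.
  have hcover : R ⊆ (Metric.closedBall c d ×ˢ (Set.univ : Set ℝ) ∩ W)
      ∪ (fun z : ℝ × ℝ => (z.1 + τ, z.2 + (g z.1 - r))) ⁻¹'
        (Metric.closedBall (c + τ) d ×ˢ (Set.univ : Set ℝ) ∩ W) := by
    rintro ⟨a, b⟩ ⟨ha, hb⟩
    simp only at ha hb
    have hb' : b ∈ Metric.closedBall y ρ :=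
      Metric.closedBall_subset_closedBall (by linarith) hb
    by_cases hmem : (a, b) ∈ D
    · right
      refine ⟨⟨?_, Set.mem_univ _⟩, ?_⟩
      · simpa [Metric.mem_closedBall, Real.dist_eq] using ha
      · rw [hW]
        refine ⟨?_, fun hmem' => hmem'.2 ?_⟩
        · rw [← closedBall_prod_same]
          refine ⟨(hsub a ha).2, ?_⟩
          have h1 := hlevel a ha
          rw [Metric.mem_closedBall, Real.dist_eq] at hb ⊢
          have h2 := abs_add_le (b - y) (g a - r)
          rw [show b - y + (g a - r) = b + (g a - r) - y by ring] at h2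
          linarith
        · have := hinv _ hmem.1
          simpa [add_assoc] using this
    · left
      refine ⟨⟨ha, Set.mem_univ _⟩, ?_⟩
      rw [hW]
      refine ⟨?_, hmem⟩
      rw [← closedBall_prod_same]
      exact ⟨(hsub a ha).1, hb'⟩
  have h1 := (measure_mono (μ := volume) hcover).trans (measure_union_le _ _)
  rw [hΦ.measure_preimage ((hm _).inter hWm).nullMeasurableSet] at h1
  have h2 : volume R = ENNReal.ofReal (2 * d * ρ) := by
    rw [hR, Measure.volume_eq_prod, Measure.prod_prod, Real.volume_closedBall,
      Real.volume_closedBall, ← ENNReal.ofReal_mul (by positivity)]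
    congr 1
    ring
  rw [h2] at h1
  have h3 := ENNReal.toReal_mono (ENNReal.add_ne_top.2 ⟨hstrip c, hstrip (c + τ)⟩) h1
  rw [ENNReal.toReal_ofReal (by positivity), ENNReal.toReal_add (hstrip c) (hstrip (c + τ))] at h3
  rw [measureReal_restrict_apply (hm _), measureReal_restrict_apply (hm _)]
  exact h3

theorem measurable_rotationSum {f : ℝ → ℝ} (hf : Measurable f) (α : ℝ) (q : ℕ) :
    Measurable (rotationSum f α q) :=
  Finset.measurable_sum _ fun _ _ => hf.comp (measurable_id.add_const _)

/-- Around a density point of the exceptional set, the strips of all chosen scales have total width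
`M ≥ ρ`. Each forces area of `W` over itself or over its image under the rotation, `ρ M` in all,
whereas the second moment bound allows only `ρ M / 4` for each of the two families. -/
theorem volume_not_mem_vertical_translate {f : ℝ → ℝ} (hf : Measurable f) {β K C r : ℝ} {Q : ℕ}
    (hK : 0 < K) (hC : 0 < C)
    (hlevel : ∀ x : ℚ, Q ≤ x.den → |β - x| ≤ 1 / (K * x.den ^ 2) → ∀ i : ℤ, ∃ z : ℝ,
      (i + 1 / 4) / x.den ≤ z ∧ z ≤ (i + 3 / 4) / x.den ∧
      ∀ ε : ℝ, ε ≤ 1 → ∀ t : ℝ, |t - z| ≤ ε / (C * x.den * Real.log x.den) →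
        |rotationSum f β x.den t - r| ≤ ε)
    (hβ : ∀ (K : ℝ) (m₀ : ℕ) (M : ℝ), 0 < K → ∃ s : Finset ℕ,
      (∀ m ∈ s, m₀ ≤ m ∧ β ∈ goodScale K m) ∧ M ≤ ∑ m ∈ s, 1 / ((m : ℝ) + 1))
    {F : Set (ℝ × ℝ)} (hF : MeasurableSet F)
    (hinv : ∀ (q : ℕ) (p : ℤ), ∀ z ∈ F, (z.1 + (q * β - p), z.2 + rotationSum f β q z.1) ∈ F) :
    volume {z : ℝ × ℝ | z ∈ F ∧ (z.1, z.2 + r) ∉ F} = 0 := by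
  by_contra hpos
  have hDm : MeasurableSet {z : ℝ × ℝ | z ∈ F ∧ (z.1, z.2 + r) ∉ F} :=
    hF.inter ((measurable_fst.prodMk (measurable_snd.add_const r)) hF).compl
  obtain ⟨⟨x₀, y⟩, ρ, hρ, hρ1, hball⟩ := exists_closedBall_diff_le volume hDm hpos
    (δ := ENNReal.ofReal (1 / 100000)) (ENNReal.ofReal_pos.2 (by norm_num)).ne' one_pos
  set W := Metric.closedBall (x₀, y) ρ \ {z : ℝ × ℝ | z ∈ F ∧ (z.1, z.2 + r) ∉ F} with hW
  have hboxfin : volume (Metric.closedBall (x₀, y) ρ) ≠ ⊤ :=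
    (isCompact_closedBall _ _).measure_lt_top.ne
  have hWfin : volume W ≠ ⊤ := ((measure_mono Set.sdiff_subset).trans_lt hboxfin.lt_top).ne
  have hWvol : volume.real W ≤ 4 * ρ ^ 2 / 100000 := by
    rw [← closedBall_prod_same, Measure.volume_eq_prod, Measure.prod_prod, Real.volume_closedBall,
      Real.volume_closedBall, ← ENNReal.ofReal_mul (by positivity),
      ← ENNReal.ofReal_mul (by positivity), ← Measure.volume_eq_prod] at hball
    refine (ENNReal.toReal_mono ENNReal.ofReal_ne_top hball).trans (le_of_eq ?_)
    rw [ENNReal.toReal_ofReal (by positivity)]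
    ring
  have hWsub : ∀ w ∈ W, w.2 ∈ Metric.closedBall y ρ := by
    intro w hw
    have h1 := hw.1
    rw [← closedBall_prod_same] at h1
    exact h1.2
  obtain ⟨m₀, hm₀⟩ := (((tendsto_pow_atTop_atTop_of_one_lt
    (one_lt_two : (1 : ℝ) < 2)).eventually_ge_atTop (4 / ρ)).and
    ((tendsto_pow_atTop_atTop_of_one_lt
    (one_lt_two : (1 : ℕ) < 2)).eventually_ge_atTop (max Q 3))).exists_forall_of_atTop
  -- Quality `K + 1` gives quality `K` and also `|q β - p| ≤ 1 / q`. The harmonic sum demanded is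
  -- what makes the total width `M` at least `ρ`.
  obtain ⟨s, hs, hsum⟩ := hβ (K + 1) m₀ (4 * (C + 8) / (ρ / 2)) (by linarith)
  choose! x hx using fun m hm => (hs m hm).2
  have hq : ∀ m ∈ s, 2 ^ m ≤ (x m).den ∧ (x m).den < 2 ^ (m + 4) := fun m hm =>
    ⟨(hx m hm).1, (hx m hm).2.1⟩
  have hq3 : ∀ m ∈ s, Q ≤ (x m).den ∧ 3 ≤ (x m).den := fun m hm => by
    have h1 := (hm₀ m (hs m hm).1).2.trans (hq m hm).1
    exact ⟨(le_max_left _ _).trans h1, (le_max_right _ _).trans h1⟩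
  have hq0 : ∀ m ∈ s, (0 : ℝ) < (x m).den := fun m _ => Nat.cast_pos.2 (x m).den_pos
  have hqρ : ∀ m ∈ s, 4 ≤ ρ * (x m).den := fun m hm => by
    have h1 := (hm₀ m (hs m hm).1).1
    have h2 : (2 : ℝ) ^ m ≤ (x m).den := by exact_mod_cast (hq m hm).1
    rw [div_le_iff₀ hρ] at h1
    nlinarith
  have hlog : ∀ m ∈ s, 1 ≤ Real.log (x m).den := fun m hm => by
    rw [Real.le_log_iff_exp_le (hq0 m hm)]
    have : (3 : ℝ) ≤ (x m).den := by exact_mod_cast (hq3 m hm).2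
    linarith [Real.exp_one_lt_three]
  have hlog' : ∀ m ∈ s, Real.log (x m).den ≤ 4 * ((m : ℝ) + 1) := fun m hm => by
    have h1 : ((x m).den : ℝ) ≤ 2 ^ (m + 4) := by exact_mod_cast (hq m hm).2.le
    have h2 := Real.log_le_log (hq0 m hm) h1
    rw [Real.log_pow] at h2
    have h3 : ((m + 4 : ℕ) : ℝ) * Real.log 2 ≤ (m + 4 : ℕ) * 1 :=
      mul_le_mul_of_nonneg_left (by linarith [Real.log_two_lt_d9]) (Nat.cast_nonneg _)
    push_cast at h2 h3
    linarith [Nat.cast_nonneg (α := ℝ) m]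
  have happ : ∀ m ∈ s, |β - x m| ≤ 1 / (K * (x m).den ^ 2) := fun m hm => by
    have := hq0 m hm
    refine (hx m hm).2.2.trans (one_div_le_one_div_of_le (by positivity) ?_)
    gcongr
    linarith
  have hτ : ∀ m ∈ s, |(x m).den * β - (x m).num| ≤ 1 / (x m).den := fun m hm => by
    have h0 := hq0 m hm
    have h1 : (x m).den * β - (x m).num = (x m).den * (β - x m) := by
      have : ((x m : ℚ) : ℝ) * (x m).den = (x m).num := by
        exact_mod_cast Rat.mul_den_eq_num (x m)
      rw [← this]
      ring
    rw [h1, abs_mul, Nat.abs_cast]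
    calc ((x m).den : ℝ) * |β - x m| ≤ (x m).den * (1 / ((K + 1) * (x m).den ^ 2)) :=
          mul_le_mul_of_nonneg_left (hx m hm).2.2 h0.le
      _ = 1 / ((K + 1) * (x m).den) := by field_simp
      _ ≤ 1 / (x m).den := one_div_le_one_div_of_le h0 (by nlinarith)
  choose! z hz using fun m hm => hlevel (x m) (hq3 m hm).1 (happ m hm)
  -- The radius for level tolerance `ρ / 2`, with `C` enlarged by `8` so that `q e ≤ 1/8`.
  set e : ℕ → ℝ := fun m => (ρ / 2) / ((C + 8) * (x m).den * Real.log (x m).den) with he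
  -- The `- 1` keeps the right end `(i + 1) / q` of the cell within `ρ / 2` of `x₀`. The remaining
  -- margin accommodates the displacement `q β - p`, at most `ρ / 4`.
  set I : ℕ → Finset ℤ := fun m =>
    Finset.Icc ⌈(x m).den * (x₀ - ρ / 2)⌉ (⌊(x m).den * (x₀ + ρ / 2)⌋ - 1) with hI
  have hzcell : ∀ m ∈ s, ∀ i, i + 1 / 4 ≤ (x m).den * z m i ∧ (x m).den * z m i ≤ i + 3 / 4 := by
    intro m hm i
    have h0 := hq0 m hm
    have h1 := (div_le_iff₀ h0).1 (hz m hm i).1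
    have h2 := (le_div_iff₀ h0).1 (hz m hm i).2.1
    constructor <;> linarith
  have he0 : ∀ m ∈ s, 0 < e m ∧ (x m).den * e m ≤ 1 / 8 := by
    intro m hm
    have h0 := hq0 m hm
    have h1 := hlog m hm
    refine ⟨by simp only [he]; positivity, ?_⟩
    have h2 : (x m).den * e m = (ρ / 2) / ((C + 8) * Real.log (x m).den) := by
      simp only [he]
      field_simp
    rw [h2, div_le_iff₀ (by positivity)]
    nlinarith
  have hcard : ∀ m ∈ s, ρ * (x m).den / 2 ≤ (I m).card ∧ ((I m).card : ℝ) ≤ 2 * ρ * (x m).den := by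
    intro m hm
    have h0 := hq0 m hm
    have h1 := hqρ m hm
    constructor
    · simp only [hI, Int.card_Icc]
      have h2 : ((⌊(x m).den * (x₀ + ρ / 2)⌋ - 1 + 1 - ⌈(x m).den * (x₀ - ρ / 2)⌉ : ℤ) : ℝ)
          ≤ ((⌊(x m).den * (x₀ + ρ / 2)⌋ - 1 + 1 - ⌈(x m).den * (x₀ - ρ / 2)⌉).toNat : ℕ) := by
        exact_mod_cast Int.self_le_toNat _
      push_cast at h2
      have h3 := Int.lt_floor_add_one ((x m).den * (x₀ + ρ / 2))
      have h4 := Int.ceil_lt_add_one ((x m).den * (x₀ - ρ / 2))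
      refine le_trans ?_ h2
      nlinarith
    · refine (card_int_le (a := (x m).den * (x₀ - ρ / 2)) (b := (x m).den * (x₀ + ρ / 2) - 1)
        (by nlinarith) fun i hi => ?_).trans (by nlinarith)
      obtain ⟨h2, h3⟩ := Finset.mem_Icc.1 hi
      refine ⟨Int.ceil_le.1 h2, ?_⟩
      have h4 := Int.le_floor.1 (show i + 1 ≤ ⌊(x m).den * (x₀ + ρ / 2)⌋ by omega)
      push_cast at h4
      linarith
  set M := ∑ m ∈ s, (I m).card * (2 * e m) with hM
  have hMρ : ρ ≤ M := by
    have h1 : ∀ m ∈ s, ρ * (ρ / 2) / (4 * (C + 8)) * (1 / ((m : ℝ) + 1))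
        ≤ (I m).card * (2 * e m) := by
      intro m hm
      have h0 := hq0 m hm
      have h2 := hlog m hm
      calc ρ * (ρ / 2) / (4 * (C + 8)) * (1 / ((m : ℝ) + 1))
          = ρ * (ρ / 2) / ((C + 8) * (4 * ((m : ℝ) + 1))) := by field_simp
        _ ≤ ρ * (ρ / 2) / ((C + 8) * Real.log (x m).den) := by
            have := hlog' m hm
            gcongr
        _ = ρ * (x m).den / 2 * (2 * e m) := by
            simp only [he]
            field_simp
        _ ≤ _ := mul_le_mul_of_nonneg_right (hcard m hm).1 (by linarith [(he0 m hm).1])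
    have h2 := Finset.sum_le_sum h1
    rw [← Finset.mul_sum] at h2
    refine le_trans ?_ h2
    calc ρ = ρ * (ρ / 2) / (4 * (C + 8)) * (4 * (C + 8) / (ρ / 2)) := by field_simp
      _ ≤ _ := mul_le_mul_of_nonneg_left hsum (by positivity)
  have hM0 : 0 < M := hρ.trans_le hMρ
  have hV : ∀ t : ℕ → ℝ, ∑ a ∈ s.sigma I, ∑ b ∈ s.sigma I, volume.real
        (Metric.closedBall (z a.1 a.2 + t a.1) (e a.1) ∩
          Metric.closedBall (z b.1 b.2 + t b.1) (e b.1)) ≤ 772 * M ^ 2 / ρ := by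
    intro t
    refine (sum_overlap_le t hρ hq (fun m hm i _ => ?_) (fun m hm => ?_) hcard).trans ?_
    · have := hzcell m hm i
      constructor <;> linarith
    · exact ⟨(he0 m hm).1.le, (he0 m hm).2⟩
    · rw [← hM]
      -- Here `M ≥ ρ` is needed: only then is the linear term dominated by the quadratic one.
      have h1 : M ≤ M ^ 2 / ρ := by
        rw [le_div_iff₀ hρ]
        nlinarith
      have h2 : 2 * (2 / ρ * M ^ 2 + 2 * 192 * M) = 4 * (M ^ 2 / ρ) + 768 * M := by ring
      have h3 : 772 * M ^ 2 / ρ = 772 * (M ^ 2 / ρ) := by ring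
      linarith
  have hS1 := sum_strip_le (s := s.sigma I) (c := fun a => z a.1 a.2 + 0) (d := fun a => e a.1)
    hρ hM0 hWfin hWsub hWvol (hV fun _ => 0)
  have hS2 := sum_strip_le (s := s.sigma I)
    (c := fun a => z a.1 a.2 + ((x a.1).den * β - (x a.1).num)) (d := fun a => e a.1)
    hρ hM0 hWfin hWsub hWvol (hV fun m => (x m).den * β - (x m).num)
  have hrect : ∀ a ∈ s.sigma I, 2 * e a.1 * ρ
      ≤ (volume.restrict W).real (Metric.closedBall (z a.1 a.2 + 0) (e a.1) ×ˢ Set.univ)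
        + (volume.restrict W).real (Metric.closedBall
          (z a.1 a.2 + ((x a.1).den * β - (x a.1).num)) (e a.1) ×ˢ Set.univ) := by
    rintro ⟨m, i⟩ ha
    obtain ⟨hm, hi⟩ := Finset.mem_sigma.1 ha
    simp only at hm hi ⊢
    have h0 := hq0 m hm
    have h1 := hlog m hm
    obtain ⟨hi1, hi2⟩ := Finset.mem_Icc.1 hi
    have hi1 := Int.ceil_le.1 hi1
    have hi2 := Int.le_floor.1 (show i + 1 ≤ ⌊(x m).den * (x₀ + ρ / 2)⌋ by omega)
    push_cast at hi2
    rw [add_zero]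
    refine rectangle_le_strips hF (measurable_rotationSum hf β (x m).den) hρ (he0 m hm).1.le
      (hinv (x m).den (x m).num) (fun a ha => ?_) (fun a ha => ?_) hW
    · refine (hz m hm i).2.2 (ρ / 2) (by linarith) a ?_
      rw [Metric.mem_closedBall, Real.dist_eq] at ha
      refine ha.trans ?_
      simp only [he]
      gcongr
      linarith
    · rw [Metric.mem_closedBall, Real.dist_eq] at ha
      have h2 : |(x m).den * (a - z m i)| ≤ 1 / 8 := by
        rw [abs_mul, Nat.abs_cast]
        exact (mul_le_mul_of_nonneg_left ha h0.le).trans (he0 m hm).2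
      have h3 := abs_le.1 h2
      have h4 := hzcell m hm i
      have h5 : x₀ - ρ / 2 ≤ a := le_of_mul_le_mul_left (by linarith) h0
      have h6 : a ≤ x₀ + ρ / 2 := le_of_mul_le_mul_left (by linarith) h0
      have h7 : 1 / ((x m).den : ℝ) ≤ ρ / 4 := by
        rw [div_le_iff₀ h0]
        linarith [hqρ m hm]
      have h8 := abs_le.1 ((hτ m hm).trans h7)
      simp only [Metric.mem_closedBall, Real.dist_eq, abs_le]
      refine ⟨⟨?_, ?_⟩, ⟨?_, ?_⟩⟩ <;> linarith
  have htotal := Finset.sum_le_sum hrect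
  rw [Finset.sum_add_distrib] at htotal
  have hleft : ∑ a ∈ s.sigma I, 2 * e a.1 * ρ = ρ * M := by
    rw [Finset.sum_sigma, hM, Finset.mul_sum]
    refine Finset.sum_congr rfl fun m _ => ?_
    simp only [Finset.sum_const, nsmul_eq_mul]
    ring
  rw [hleft] at htotal
  -- The three bounds now read `ρ M ≤ ρ M / 4 + ρ M / 4`.
  have := mul_pos hρ hM0
  linarith

/-! ### Passage between the line and the circle -/

theorem ae_addCircle_of_ae_real {P : UnitAddCircle → Prop}
    (h : ∀ᵐ β : ℝ, P (β : UnitAddCircle)) : ∀ᵐ α ∂(volume : Measure UnitAddCircle), P α := by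
  have h1 := (AddCircle.measurePreserving_equivIoc (T := 1) (a := 0)).quasiMeasurePreserving.ae
    (p := fun u => P ((u : ℝ) : UnitAddCircle)) (by
      have h2 : ∀ᵐ (β : ℝ) ∂(Measure.map Subtype.val
          (Measure.comap (Subtype.val : Set.Ioc (0 : ℝ) (0 + 1) → ℝ) volume)),
          P (β : UnitAddCircle) := by
        rw [map_comap_subtype_coe measurableSet_Ioc]
        exact ae_restrict_of_ae h
      exact ae_of_ae_map measurable_subtype_coe.aemeasurable h2)
  filter_upwards [h1] with α hα
  have : ((AddCircle.equivIoc (1 : ℝ) 0 α : ℝ) : UnitAddCircle) = α :=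
    (AddCircle.equivIoc (1 : ℝ) 0).symm_apply_apply α
  rwa [this] at hα

theorem ae_addOrderOf_eq_zero :
    ∀ᵐ α ∂(volume : Measure UnitAddCircle), addOrderOf α = 0 := by
  refine ae_addCircle_of_ae_real ?_
  filter_upwards [(Set.countable_range ((↑) : ℚ → ℝ)).ae_notMem volume] with β hβ
  by_contra hne
  have h1 := addOrderOf_nsmul_eq_zero (β : UnitAddCircle)
  rw [← AddCircle.coe_nsmul] at h1
  obtain ⟨k, hk⟩ := (AddCircle.coe_eq_zero_iff (1 : ℝ)).1 h1
  refine hβ ⟨k / addOrderOf (β : UnitAddCircle), ?_⟩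
  simp only [zsmul_eq_mul, mul_one, nsmul_eq_mul] at hk
  have h2 : (addOrderOf (β : UnitAddCircle) : ℝ) ≠ 0 := Nat.cast_ne_zero.2 hne
  push_cast
  rw [hk]
  field_simp

theorem coe_add_one_circle (t : ℝ) : ((t + 1 : ℝ) : UnitAddCircle) = t :=
  AddCircle.coe_add_period 1 t

theorem lift_periodic (φ : UnitAddCircle → ℝ) (x₀ : UnitAddCircle) :
    Function.Periodic (fun t : ℝ => φ (x₀ + (t : UnitAddCircle))) 1 := fun t => by
  simp only [coe_add_one_circle]

theorem coe_ne_zero_of_mem_Ioo {t : ℝ} (ht : t ∈ Set.Ioo (0 : ℝ) 1) : (t : UnitAddCircle) ≠ 0 := by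
  intro h
  obtain ⟨n, hn⟩ := (AddCircle.coe_eq_zero_iff (1 : ℝ)).1 h
  simp only [zsmul_eq_mul, mul_one] at hn
  rw [← hn] at ht
  have h1 : (0 : ℤ) < n := by exact_mod_cast ht.1
  have h2 : n < (1 : ℤ) := by exact_mod_cast ht.2
  omega

theorem HasLogSingularityWith.logProfile {φ : UnitAddCircle → ℝ} {x₀ : UnitAddCircle} {A B : ℝ}
    (h : HasLogSingularityWith φ x₀ A B) :
    LogProfile (fun t : ℝ => φ (x₀ + (t : UnitAddCircle)))
      (deriv fun t : ℝ => φ (x₀ + (t : UnitAddCircle)))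
      (iteratedDeriv 2 fun t : ℝ => φ (x₀ + (t : UnitAddCircle))) A B := by
  set f : ℝ → ℝ := fun t => φ (x₀ + (t : UnitAddCircle)) with hf
  have hcd : ContDiffOn ℝ (1 + 1) f (Set.Ioo 0 1) := by
    have := h.contDiffOn.mono (fun t ht => by
      simpa using coe_ne_zero_of_mem_Ioo ht : Set.Ioo (0 : ℝ) 1 ⊆ _)
    exact this.of_le (by norm_num)
  have h1 := (contDiffOn_succ_iff_deriv_of_isOpen isOpen_Ioo).1 hcd
  have h2 := (contDiffOn_succ_iff_deriv_of_isOpen (n := 0) isOpen_Ioo).1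
    (by simpa using h1.2.2)
  have hit : iteratedDeriv 2 f = deriv (deriv f) := by
    rw [iteratedDeriv_succ, iteratedDeriv_one]
  refine ⟨fun t ht => ?_, fun t ht => ?_, ?_, h.tendsto_right, ?_⟩
  · exact (h1.1.differentiableAt (isOpen_Ioo.mem_nhds ht)).hasDerivAt
  · rw [hit]
    exact (h2.1.differentiableAt (isOpen_Ioo.mem_nhds ht)).hasDerivAt
  · rw [hit]
    exact h2.2.2.continuousOn
  -- Periodicity transports the left limit at `0` to a left limit at `1`.
  · have hper : ∀ t, iteratedDeriv 2 f (t - 1) = iteratedDeriv 2 f t := by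
      intro t
      have h3 : (fun s => f (s - 1)) = f := by
        ext s
        exact (lift_periodic φ x₀).sub_eq s
      have h4 := congrFun (iteratedDeriv_comp_sub_const 2 f 1) t
      rw [h3] at h4
      exact h4.symm
    have hsub : Tendsto (fun t : ℝ => t - 1) (𝓝[<] 1) (𝓝[<] 0) := by
      refine tendsto_nhdsWithin_iff.2 ⟨?_, ?_⟩
      · have : Tendsto (fun t : ℝ => t - 1) (𝓝 1) (𝓝 (1 - 1)) :=
          (continuous_sub_right (1 : ℝ)).tendsto 1
        rw [sub_self] at this
        exact this.mono_left nhdsWithin_le_nhds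
      · filter_upwards [self_mem_nhdsWithin] with t ht
        simpa using ht
    refine (h.tendsto_left.comp hsub).congr fun t => ?_
    simp only [Function.comp]
    rw [hper t]
    ring

/-- Continuity of the lift descends through the open quotient map, so `φ` is continuous off `x₀`; a
single point does not affect measurability. -/
theorem HasLogSingularityWith.measurable {φ : UnitAddCircle → ℝ} {x₀ : UnitAddCircle} {A B : ℝ}
    (h : HasLogSingularityWith φ x₀ A B) : Measurable φ := by
  refine measurable_of_continuousOn_compl_singleton x₀
    (continuousOn_of_forall_continuousAt fun x hx => ?_)
  have hx : x ≠ x₀ := hx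
  obtain ⟨t, ht⟩ := QuotientAddGroup.mk_surjective (x - x₀)
  have ht' : x₀ + (t : UnitAddCircle) = x := by
    change x₀ + (QuotientAddGroup.mk t) = x
    rw [ht]
    abel
  have hopen : IsOpen {t : ℝ | x₀ + (t : UnitAddCircle) ≠ x₀} :=
    isOpen_ne_fun (continuous_const.add (AddCircle.continuous_mk' 1)) continuous_const
  have hcont : ContinuousAt ((fun y => φ (x₀ + y)) ∘ (QuotientAddGroup.mk : ℝ → UnitAddCircle)) t :=
    h.contDiffOn.continuousOn.continuousAt (hopen.mem_nhds (by
      rw [Set.mem_ofPred_eq, ht']; exact hx))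
  have hcont' : ContinuousAt (fun y => φ (x₀ + y)) (x - x₀) := by
    rw [← ht]
    exact QuotientAddGroup.isOpenQuotientMap_mk.continuousAt_comp_iff.1 hcont
  have hfin : ContinuousAt (fun y => φ (x₀ + (y - x₀))) x :=
    ContinuousAt.comp (f := fun y => y - x₀) hcont' (by fun_prop)
  simpa using hfin

theorem integral_lift_eq_zero {φ : UnitAddCircle → ℝ} (x₀ : UnitAddCircle)
    (h : ∫ x, φ x = 0) : ∫ t in (0 : ℝ)..1, φ (x₀ + (t : UnitAddCircle)) = 0 := by
  have := AddCircle.intervalIntegral_preimage (1 : ℝ) 0 (fun y => φ (x₀ + y))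
  rw [zero_add] at this
  rw [this, ← h]
  exact integral_add_left_eq_self φ x₀

theorem measurePreserving_cylindricalCascade {φ : UnitAddCircle → ℝ} (hφ : Measurable φ)
    (α : UnitAddCircle) :
    MeasurePreserving (cylindricalCascade α φ)
      ((volume : Measure UnitAddCircle).prod (volume : Measure ℝ))
      ((volume : Measure UnitAddCircle).prod (volume : Measure ℝ)) :=
  (measurePreserving_add_right volume α).skew_product (g := fun x y => φ x + y) (by fun_prop)
    (ae_of_all _ fun x => (measurePreserving_add_left volume (φ x)).map_eq)

/-! ### From vertical invariance to ergodicity -/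

/-- A measurable subset of `X × ℝ` which is almost invariant under every vertical translation has
almost all its sections null or of null complement. -/
theorem ae_section_null_or_conull {X : Type*} [MeasurableSpace X] {μ : Measure X} [SFinite μ]
    {F : Set (X × ℝ)} (hF : MeasurableSet F)
    (h : ∀ r : ℝ, (μ.prod volume) {z | z ∈ F ∧ (z.1, z.2 + r) ∉ F} = 0) :
    ∀ᵐ x ∂μ, volume (Prod.mk x ⁻¹' F) = 0 ∨ volume (Prod.mk x ⁻¹' F)ᶜ = 0 := by
  have hmeas : MeasurableSet {w : ℝ × (X × ℝ) | w.2 ∈ F ∧ (w.2.1, w.2.2 + w.1) ∉ F} :=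
    (measurable_snd hF).inter
      ((Measurable.prodMk (by fun_prop) (by fun_prop) :
        Measurable fun w : ℝ × (X × ℝ) => (w.2.1, w.2.2 + w.1)) hF).compl
  have h1 : ((volume : Measure ℝ).prod (μ.prod volume))
      {w : ℝ × (X × ℝ) | w.2 ∈ F ∧ (w.2.1, w.2.2 + w.1) ∉ F} = 0 := by
    rw [Measure.measure_prod_null hmeas]
    exact ae_of_all _ h
  -- Fubini exchanges "for each `r`, almost every `z`" for "for almost every `z`, almost every `r`".
  have h2 : ∀ᵐ z ∂(μ.prod volume), ∀ᵐ r : ℝ, ¬(z ∈ F ∧ (z.1, z.2 + r) ∉ F) := by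
    have h3 : ∀ᵐ w ∂((volume : Measure ℝ).prod (μ.prod volume)),
        ¬(w.2 ∈ F ∧ (w.2.1, w.2.2 + w.1) ∉ F) := by
      rw [ae_iff]
      simpa using h1
    have h4 := (Measure.measurePreserving_swap (μ := μ.prod volume)
      (ν := (volume : Measure ℝ))).quasiMeasurePreserving.ae h3
    exact Measure.ae_ae_of_ae_prod h4
  filter_upwards [Measure.ae_ae_of_ae_prod h2] with x hx
  by_cases h0 : volume (Prod.mk x ⁻¹' F) = 0
  · exact Or.inl h0
  right
  -- One typical point of a non-null section suffices: almost all of its translates are in the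
  -- section, and they fill the line.
  obtain ⟨y, hyF, hy⟩ := (frequently_ae_iff.2 h0 |>.and_eventually hx).exists
  have h5 : ∀ᵐ r : ℝ, (x, y + r) ∈ F := hy.mono fun r hr => by
    by_contra hcon
    exact hr ⟨hyF, hcon⟩
  have h6 := (measurePreserving_add_left (volume : Measure ℝ) (-y)).quasiMeasurePreserving.ae h5
  have h7 : ∀ᵐ r : ℝ, r ∈ Prod.mk x ⁻¹' F := h6.mono fun r hr => by simpa using hr
  exact ae_iff.1 h7

theorem rotation_iterate_mem {φ : UnitAddCircle → ℝ} {x₀ : UnitAddCircle} {β : ℝ}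
    {F : Set (UnitAddCircle × ℝ)} (hinv : cylindricalCascade β φ ⁻¹' F = F) (q : ℕ) (p : ℤ)
    (z : ℝ × ℝ) (hz : (x₀ + (z.1 : UnitAddCircle), z.2) ∈ F) :
    (x₀ + ((z.1 + (q * β - p) : ℝ) : UnitAddCircle),
      z.2 + rotationSum (fun t : ℝ => φ (x₀ + (t : UnitAddCircle))) β q z.1) ∈ F := by
  have hp : ((p : ℝ) : UnitAddCircle) = 0 :=
    (AddCircle.coe_eq_zero_iff (1 : ℝ)).2 ⟨p, by simp⟩
  have key : (x₀ + ((z.1 + q * β : ℝ) : UnitAddCircle),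
      z.2 + rotationSum (fun t : ℝ => φ (x₀ + (t : UnitAddCircle))) β q z.1) ∈ F := by
    induction q with
    | zero => simpa [rotationSum] using hz
    | succ n ih =>
      rw [← hinv] at ih
      have h1 := Set.mem_preimage.1 ih
      unfold cylindricalCascade at h1
      simp only at h1
      convert h1 using 2
      · push_cast
        rw [add_mul, one_mul, ← add_assoc, AddCircle.coe_add, AddCircle.coe_add]
        abel
      · unfold rotationSum
        rw [Finset.sum_range_succ]
        ring
  rwa [← add_sub_assoc, AddCircle.coe_sub, hp, sub_zero]

theorem ae_circle_of_ae_lift {P : UnitAddCircle → Prop} (x₀ : UnitAddCircle)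
    (h : ∀ᵐ t : ℝ, P (x₀ + (t : UnitAddCircle))) :
    ∀ᵐ x ∂(volume : Measure UnitAddCircle), P x := by
  have h1 := (measurePreserving_add_left (volume : Measure UnitAddCircle)
    (-x₀)).quasiMeasurePreserving.ae (ae_addCircle_of_ae_real (P := fun x => P (x₀ + x)) h)
  filter_upwards [h1] with x hx
  simpa using hx

/-- The map carries fibres to fibres by translations, so the set of base points with conull section
is invariant under the rotation. As `α` has infinite order, that set is null or conull, and since
sections are null or conull, so is `F`. -/
theorem ergodic_cylindricalCascade_of_vertical {α x₀ : UnitAddCircle} {φ : UnitAddCircle → ℝ}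
    (hφ : Measurable φ) (hα : addOrderOf α = 0)
    (h : ∀ F : Set (UnitAddCircle × ℝ), MeasurableSet F → cylindricalCascade α φ ⁻¹' F = F →
      ∀ r : ℝ, volume {z : ℝ × ℝ | (x₀ + (z.1 : UnitAddCircle), z.2) ∈ F ∧
        (x₀ + (z.1 : UnitAddCircle), z.2 + r) ∉ F} = 0) :
    Ergodic (cylindricalCascade α φ)
      ((volume : Measure UnitAddCircle).prod (volume : Measure ℝ)) := by
  refine ⟨measurePreserving_cylindricalCascade hφ α, ⟨fun F hF hinv => ?_⟩⟩
  have hlift : Measurable fun z : ℝ × ℝ => (x₀ + (z.1 : UnitAddCircle), z.2) :=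
    ((measurable_const.add ((AddCircle.continuous_mk' (1 : ℝ)).measurable.comp
      measurable_fst)).prodMk measurable_snd)
  have hsec : ∀ᵐ x ∂(volume : Measure UnitAddCircle),
      volume (Prod.mk x ⁻¹' F) = 0 ∨ volume (Prod.mk x ⁻¹' F)ᶜ = 0 :=
    ae_circle_of_ae_lift x₀ (ae_section_null_or_conull (μ := volume) (hlift hF)
      fun r => h F hF hinv r)
  set X₁ : Set UnitAddCircle := {x | volume (Prod.mk x ⁻¹' Fᶜ) = 0} with hX₁
  have hX₁m : MeasurableSet X₁ :=
    (measurable_measure_prodMk_left hF.compl) (measurableSet_singleton 0)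
  have hX₁inv : (· + α) ⁻¹' X₁ = X₁ := by
    ext x
    simp only [hX₁, Set.mem_preimage, Set.mem_ofPred_eq]
    have h1 : Prod.mk x ⁻¹' Fᶜ = (fun y => φ x + y) ⁻¹' (Prod.mk (x + α) ⁻¹' Fᶜ) := by
      conv_lhs => rw [← hinv]
      rfl
    rw [h1, (measurePreserving_add_left (volume : Measure ℝ) (φ x)).measure_preimage
      (measurable_prodMk_left hF.compl).nullMeasurableSet]
  rcases (AddCircle.ergodic_add_right.2 hα).toPreErgodic.measure_self_or_compl_eq_zero hX₁m
    hX₁inv with h0 | h0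
  · have h1 : ((volume : Measure UnitAddCircle).prod (volume : Measure ℝ)) F = 0 := by
      rw [Measure.measure_prod_null hF]
      have h2 : ∀ᵐ x ∂(volume : Measure UnitAddCircle), x ∉ X₁ := measure_eq_zero_iff_ae_notMem.1 h0
      filter_upwards [hsec, h2] with x hx1 hx2
      exact hx1.resolve_right hx2
    exact eventuallyConst_set'.2 (Or.inl (ae_eq_empty.2 h1))
  · have h1 : ((volume : Measure UnitAddCircle).prod (volume : Measure ℝ)) Fᶜ = 0 := by
      rw [Measure.measure_prod_null hF.compl]
      filter_upwards [measure_eq_zero_iff_ae_notMem.1 h0] with x hx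
      exact not_not.1 hx
    exact eventuallyConst_set'.2 (Or.inr (ae_eq_univ.2 h1))

theorem theoremp4 :
    ∀ᵐ α ∂(volume : Measure UnitAddCircle),
      ∀ (x₀ : UnitAddCircle) (φ : UnitAddCircle → ℝ),
        HasAsymmetricLogSingularity φ x₀ →
        ∫ x, φ x ∂(volume : Measure UnitAddCircle) = 0 →
        Ergodic (cylindricalCascade α φ)
          ((volume : Measure UnitAddCircle).prod (volume : Measure ℝ)) := by
  -- The arithmetic condition holds for all `K` at once and does not involve `φ`, so the exceptional
  -- null set is fixed before `K` and `C` are obtained from `φ`.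
  have hgood : ∀ᵐ α ∂(volume : Measure UnitAddCircle), ∃ β : ℝ, (β : UnitAddCircle) = α ∧
      ∀ (K : ℝ) (m₀ : ℕ) (M : ℝ), 0 < K → ∃ s : Finset ℕ,
        (∀ m ∈ s, m₀ ≤ m ∧ β ∈ goodScale K m) ∧ M ≤ ∑ m ∈ s, 1 / ((m : ℝ) + 1) :=
    ae_addCircle_of_ae_real (ae_exists_finset_goodScale.mono fun β hβ => ⟨β, rfl, hβ⟩)
  filter_upwards [hgood, ae_addOrderOf_eq_zero] with α hα horder x₀ φ hφ hint
  obtain ⟨β, rfl, hβ⟩ := hα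
  obtain ⟨A, B, hsing, hAB⟩ := hφ
  refine ergodic_cylindricalCascade_of_vertical (x₀ := x₀) hsing.measurable horder
    fun F hF hinv r => ?_
  obtain ⟨K, C, hK, hC, hlevels⟩ := hsing.logProfile.exists_level_points hAB (lift_periodic φ x₀)
    (integral_lift_eq_zero x₀ hint)
  obtain ⟨Q, hQ⟩ := hlevels r
  have hcoe : Measurable fun t : ℝ => x₀ + (t : UnitAddCircle) :=
    measurable_const.add (AddCircle.continuous_mk' (1 : ℝ)).measurable
  exact volume_not_mem_vertical_translate (hsing.measurable.comp hcoe) hK hC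
    (fun x hx hxβ => hQ x β hx hxβ) hβ
    (F := (fun z : ℝ × ℝ => (x₀ + (z.1 : UnitAddCircle), z.2)) ⁻¹' F)
    (((hcoe.comp measurable_fst).prodMk measurable_snd) hF) (rotation_iterate_mem hinv)
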